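/- **Setting.** There are $n=3f+1$ processes, at most $f$ of them faulty (behaving arbitrarily, but unable to forge signatures). The network is partially synchronous: a message sent by a correct process to a correct process at time $s$ is received by time $\max(s,\mathrm{GST})+\Delta$, where $\Delta>0$. Local computation takes no time, and every correct process has started (entered view $1$) by $\mathrm{GST}$. Every view $v\ge 1$ has a leader $l_v$; the view is called *correct* if $l_v$ is correct. The correct processes run the pBeeGees protocol with prudence degree $PD\ge 1$: * *Blocks.* The genesis block has view $0$. A block generated after a vote in view $v$ carries a quorum certificate (QC), i.e. $n-f$ votes of one type for its parent, which is a block of view $v-1$ (or the genesis block, if $v=1$); its counter $cnt\_tmo$ is $0$. A block generated after a timeout in view $v$ carries $n-f$ timeout messages for view $v-1$ (a timeout certificate, TC), each containing the sender's $high\_vote$ block; its parent is a block of highest rank among these (rank: by view, then by the view of the block certified by the carried QC), it takes over the QC of its parent, and its $cnt\_tmo$ is that of the parent plus one. * *Validation.* A block is valid if it has this form, is signed by the leader of its view, has $cnt\_tmo\le PD$, and, when generated after a timeout, has a valid parent. It is *prudent* if $cnt\_tmo=PD$. An *equivocation is detected* in a block generated after a timeout if one is detected in its parent, or if its timeout messages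 contain a block different from its parent, of the same rank, that conflicts with the block certified by its QC. Votes have type $prud$ if the block is prudent and $eqvc$ if an equivocation is detected (possibly both), and type $normal$ otherwise; a QC has the type of its votes. * *Voting.* On receiving a valid block of a view not below its own, a process enters that view and votes for the block, at most once per view and not after having timed out in that or a later view; the vote goes to the leader of the next view, and $high\_vote$ becomes the block (its parent, if it is prudent). * *Views.* A process whose waiting time $F(v)=5\Delta$ in view $v$ has expired broadcasts a timeout message for $v$ and forwards the block it has received in view $v$, if any. A process that has received valid timeout messages of $f+1$ processes for a view that it has not left broadcasts its own; with those of $n-f$ processes it enters the next view. A timeout message for $w$ is valid if its $high\_vote$ is a valid non-prudent block of view at most $w$. The leader $l_{v+1}$, on receiving $n-f$ votes of one type for one block of view $v$ while its own view is at most $v$, enters view $v+1$. A correct leader that enters its view broadcasts a new block generated from the QC or TC by which it entered. * *Commitment.* On receiving or generating a valid block $B$, let $B_1$ be the nearest block certified by a non-prudent QC on the chain of $B$, and $B_2$ the next such block, found from $B_1$ in the same way. If the QC of $B_1$ has type $normal$, then $B_2$ and all its ancestors are committed. **Theorem (pBeeGees Liveness Theorem).** Let $v\ge 1$ and $v'>v+1$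 be such that the views $v$, $v+1$, $v'$, $v'+1$ are correct and no correct process enters view $v$ before $\mathrm{GST}$. Assume ideal conditions in the following sense: the block proposed in view $v$ is not prudent, and the block proposed in view $v'$ is neither prudent nor is an equivocation detected in it. Then $l_v$ proposes exactly one block $B_v$ in view $v$; some correct process enters view $v'+1$; and if $T$ is the time at which the first correct process does so, then every correct process has committed $B_v$ by time $T+\Delta$. -/

import Mathlib

namespace PBeeGees

/-- The `n = 3f + 1` participants. -/
abbrev Pid (f : ℕ) := Fin (3 * f + 1)

/-- The four vote types; a quorum certificate has the type of the votes it consists of. -/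
inductive VoteType where
  | normal
  | prud
  | eqvc
  | prudEqvc

def VoteType.IsPrud : VoteType → Prop
  | .normal => False
  | .prud => True
  | .eqvc => False
  | .prudEqvc => True

/-- Blocks. Hash links are replaced by the objects they point to, so a block is a finite tree that
contains its ancestors and everything else it refers to. Apart from the hard-coded genesis block
there are blocks generated after a vote (`byQC`) and blocks generated after a timeout (`byTC`).
Every entry of a block is chosen freely by its proposer; what is acceptable is decided by the
validation rules below.

A quorum certificate for the block `qcBlock` of type `qcType` is the family of the votes of the
processes in `qcSigners`. The timeout certificate of a `byTC` block of view `v`, together with its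
`tmo_set`, is the family of the timeout messages for view `v - 1` of the processes in `tmoSigners`,
the message of `p` having `tmoHigh p` as its `high_vote`. -/
inductive Block (f : ℕ) (C : Type*) where
  | genesis : Block f C
  | byQC (proposer : Pid f) (view : ℕ) (cmd : C) (parent : Block f C)
      (qcBlock : Block f C) (qcType : VoteType) (qcSigners : Finset (Pid f)) : Block f C
  | byTC (proposer : Pid f) (view : ℕ) (cmd : C) (parent : Block f C)
      (qcBlock : Block f C) (qcType : VoteType) (qcSigners : Finset (Pid f)) (cntTmo : ℕ)
      (tmoSigners : Finset (Pid f)) (tmoHigh : {p // p ∈ tmoSigners} → Block f C) : Block f C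

/-- A quorum certificate. -/
structure Cert (f : ℕ) (C : Type*) where
  block : Block f C
  type : VoteType
  signers : Finset (Pid f)

namespace Block

variable {f : ℕ} {C : Type*}

def proposer : Block f C → Option (Pid f)
  | genesis => none
  | byQC i _ _ _ _ _ _ => some i
  | byTC i _ _ _ _ _ _ _ _ _ => some i

/-- The view of a block; the genesis block has view `0`, all proposals belong to views `≥ 1`. -/
def view : Block f C → ℕ
  | genesis => 0
  | byQC _ v _ _ _ _ _ => v
  | byTC _ v _ _ _ _ _ _ _ _ => v

def parent : Block f C → Block f C
  | genesis => genesis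
  | byQC _ _ _ b _ _ _ => b
  | byTC _ _ _ b _ _ _ _ _ _ => b

/-- The quorum certificate carried by a block. The genesis block counts as certified by itself. -/
def qc : Block f C → Cert f C
  | genesis => ⟨genesis, .normal, ∅⟩
  | byQC _ _ _ _ b τ Q => ⟨b, τ, Q⟩
  | byTC _ _ _ _ b τ Q _ _ _ => ⟨b, τ, Q⟩

/-- The counter `cnt_tmo`; it is zero for blocks generated after a vote. -/
def cntTmo : Block f C → ℕ
  | genesis => 0
  | byQC _ _ _ _ _ _ _ => 0
  | byTC _ _ _ _ _ _ _ c _ _ => c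

/-- `a` is `b` or an ancestor of `b`. -/
def IsAncestorOrSelf (a b : Block f C) : Prop := ∃ k : ℕ, parent^[k] b = a

/-- `a` and `b` do not lie on one chain. -/
def Conflicts (a b : Block f C) : Prop := ¬ IsAncestorOrSelf a b ∧ ¬ IsAncestorOrSelf b a

/-- The ranking rule: compare the views, then the views of the carried certificates. -/
def Outranks (a b : Block f C) : Prop :=
  b.view < a.view ∨ (a.view = b.view ∧ b.qc.block.view < a.qc.block.view)

def SameRank (a b : Block f C) : Prop := ¬ Outranks a b ∧ ¬ Outranks b a

end Block

/-- The messages. Each of them is signed, a proposal by the proposer of the block, a vote and a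
timeout message by its first component. A vote is for a block and has a type; a timeout message for
a view contains the block of the `high_vote` field of its sender. -/
inductive Msg (f : ℕ) (C : Type*) where
  | proposal (b : Block f C) : Msg f C
  | vote (p : Pid f) (τ : VoteType) (b : Block f C) : Msg f C
  | timeout (p : Pid f) (w : ℕ) (high : Block f C) : Msg f C

namespace Msg

variable {f : ℕ} {C : Type*}

def signer : Msg f C → Option (Pid f)
  | proposal b => b.proposer
  | vote p _ _ => some p
  | timeout p _ _ => some p

end Msg

/-- All signed statements that occur anywhere in a block. -/
def Block.statements {f : ℕ} {C : Type*} : Block f C → Set (Msg f C)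
  | .genesis => ∅
  | .byQC i v c par qb τ Q =>
      {Msg.proposal (.byQC i v c par qb τ Q)} ∪ par.statements ∪ qb.statements ∪
        {m | ∃ p ∈ Q, m = Msg.vote p τ qb}
  | .byTC i v c par qb τ Q k T high =>
      {Msg.proposal (.byTC i v c par qb τ Q k T high)} ∪ par.statements ∪ qb.statements ∪
        {m | ∃ p ∈ Q, m = Msg.vote p τ qb} ∪
        {m | ∃ p : {p // p ∈ T}, ∃ w, v = w + 1 ∧ m = Msg.timeout p w (high p)} ∪
        {m | ∃ p : {p // p ∈ T}, m ∈ (high p).statements}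

/-- All signed statements that occur anywhere in a message. -/
def Msg.statements {f : ℕ} {C : Type*} : Msg f C → Set (Msg f C)
  | .proposal b => b.statements
  | .vote p τ b => {Msg.vote p τ b} ∪ b.statements
  | .timeout p w h => {Msg.timeout p w h} ∪ h.statements

/-- The data of a system: the leader of each view, the prudence degree, the command that a process
puts into its proposal for a view, the message delay bound, the global stabilization time, and the
set of the correct processes. -/
structure System (f : ℕ) (C : Type*) where
  leader : ℕ → Pid f
  PD : ℕ
  cmd : Pid f → ℕ → C
  Δ : ℝ
  GST : ℝ
  correct : Finset (Pid f)

/-- The result of block validation. -/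
inductive Verdict where
  | invalid
  | eqvc
  | normal

section Validation

variable {f : ℕ} {C : Type*}

/-- The checks of the information carried by the block itself. (Signatures are always valid, see
`IsExecution.unforgeable`.) -/
def ExplicitlyValid (S : System f C) : Block f C → Prop
  | .genesis => True
  | .byQC i v _ par qb _ Q =>
      i = S.leader v ∧ v = qb.view + 1 ∧ qb = par ∧ (qb = .genesis ∨ 2 * f + 1 ≤ Q.card)
  | .byTC i v _ par qb τ Q k T high =>
      i = S.leader v ∧ par.view < v ∧ (⟨qb, τ, Q⟩ : Cert f C) = par.qc ∧
        k = par.cntTmo + 1 ∧ k ≤ S.PD ∧ 2 * f + 1 ≤ T.card ∧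
        (∃ p, high p = par) ∧ ∀ p, ¬ (high p).Outranks par

open Classical in
/-- Traceback validation together with pre-commit validation. -/
noncomputable def validChain (S : System f C) : Block f C → Verdict
  | .genesis => .normal
  | .byQC i v c par qb τ Q =>
      if ExplicitlyValid S (.byQC i v c par qb τ Q) then .normal else .invalid
  | .byTC i v c par qb τ Q k T high =>
      if ExplicitlyValid S (.byTC i v c par qb τ Q k T high) then
        match validChain S par with
        | .invalid => .invalid
        | .eqvc => .eqvc
        | .normal =>
            if ∃ p, high p ≠ par ∧ (high p).SameRank par ∧ (high p).Conflicts qb then .eqvc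
            else .normal
      else .invalid

/-- A valid block, possibly with a detected equivocation. -/
def Valid (S : System f C) (b : Block f C) : Prop := validChain S b ≠ .invalid

/-- A prudent block. -/
def Prudent (S : System f C) (b : Block f C) : Prop := b.cntTmo = S.PD

open Classical in
/-- The type of the votes that correct processes cast for a valid block. -/
noncomputable def voteType (S : System f C) (b : Block f C) : VoteType :=
  if Prudent S b then
    if validChain S b = .eqvc then .prudEqvc else .prud
  else
    if validChain S b = .eqvc then .eqvc else .normal

/-- A timeout message for view `w` with `high_vote` block `h` is acceptable. -/
def ValidTimeout (S : System f C) (w : ℕ) (h : Block f C) : Prop :=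
  Valid S h ∧ ¬ Prudent S h ∧ h.view ≤ w

open Classical in
/-- The closest block on the chain of the given block that has a non-prudent certificate, with the
type of this certificate. -/
noncomputable def nonPrudQC : Block f C → Block f C × VoteType
  | .genesis => (.genesis, .normal)
  | .byQC _ _ _ _ qb τ _ => if τ.IsPrud then nonPrudQC qb else (qb, τ)
  | .byTC _ _ _ _ qb τ _ _ _ _ => if τ.IsPrud then nonPrudQC qb else (qb, τ)

open Classical in
/-- The commit rule. -/
noncomputable def commitRule (b : Block f C) : Option (Block f C) :=
  if (nonPrudQC b).2 = .normal then some (nonPrudQC (nonPrudQC b).1).1 else none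

/-- The blocks that a process commits because of the block `b`: the block given by the commit rule
and its ancestors. -/
def newlyCommitted (b : Block f C) : Set (Block f C) :=
  {a | ∃ x, commitRule b = some x ∧ a.IsAncestorOrSelf x}

end Validation

/-- The local state of a correct process. -/
structure State (f : ℕ) (C : Type*) where
  /-- current view, `0` before the process has started -/
  view : ℕ
  /-- the time at which the timer of the current view expires, `none` if it is not running -/
  deadline : Option ℝ
  /-- the last valid proposal of the current view that was received -/
  current : Option (Block f C)
  highVote : Block f C
  /-- the last view in which the process voted -/
  lastVoted : ℕ
  /-- the views for which the process has sent a timeout message -/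
  timedOut : Set ℕ
  /-- the votes received -/
  votes : Set (Pid f × VoteType × Block f C)
  /-- `tmos w q` is the `high_vote` of the first valid timeout message of `q` for `w` received -/
  tmos : ℕ → Pid f → Option (Block f C)
  committed : Set (Block f C)

section Algorithm

variable {f : ℕ} {C : Type*}

def State.initial : State f C where
  view := 0
  deadline := none
  current := none
  highVote := .genesis
  lastVoted := 0
  timedOut := ∅
  votes := ∅
  tmos := fun _ _ => none
  committed := {.genesis}

/-- Entering view `w` at time `t`; the waiting time in every view is `5Δ`. -/
def State.enter (S : System f C) (w : ℕ) (t : ℝ) (s : State f C) : State f C :=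
  { s with view := w, deadline := some (t + 5 * S.Δ), current := none }

def State.commitBy (b : Block f C) (s : State f C) : State f C :=
  { s with committed := s.committed ∪ newlyCommitted b }

/-- What a process sends in one step: pairs of a destination and a message. -/
abbrev Output (f : ℕ) (C : Type*) := Set (Pid f × Msg f C)

def broadcast (m : Msg f C) : Output f C := {x | x.2 = m}

/-- A process enters the view of its new block `b` and proposes `b`. -/
def propose (S : System f C) (t : ℝ) (b : Block f C) (s : State f C) : State f C × Output f C :=
  ((s.enter S b.view t).commitBy b, broadcast (.proposal b))

open Classical in
/-- A process that starts enters view `1`, whose leader proposes a child of the genesis block. -/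
noncomputable def onStart (S : System f C) (p : Pid f) (t : ℝ) (s : State f C) :
    State f C × Output f C :=
  if s.view = 0 then
    if S.leader 1 = p then
      propose S t (.byQC p 1 (S.cmd p 1) .genesis .genesis .normal ∅) s
    else (s.enter S 1 t, ∅)
  else (s, ∅)

open Classical in
/-- On a valid block a process applies the commit rule. If the view of the block is not below its
own, it enters this view and votes, once per view and not after having timed out in it or in a
later one. The vote goes to the leader of the next view. -/
noncomputable def onProposal (S : System f C) (p : Pid f) (t : ℝ) (b : Block f C)
    (s : State f C) : State f C × Output f C :=
  if Valid S b then
    let s₁ := s.commitBy b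
    if b.view < s.view then (s₁, ∅)
    else
      let s₂ := if s.view < b.view then s₁.enter S b.view t else s₁
      let s₃ := { s₂ with current := some b }
      if s.lastVoted < b.view ∧ ∀ w ∈ s.timedOut, w < b.view then
        ({ s₃ with
            lastVoted := b.view
            highVote := if Prudent S b then b.parent else b },
          {(S.leader (b.view + 1), .vote p (voteType S b) b)})
      else (s₃, ∅)
  else (s, ∅)

open Classical in
/-- The processes from which a vote of type `τ` for `b` was received. -/
noncomputable def State.voters (s : State f C) (τ : VoteType) (b : Block f C) : Finset (Pid f) :=
  Finset.univ.filter fun q => (q, τ, b) ∈ s.votes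

open Classical in
/-- The leader of the next view that gets `n - f` votes of one type for one block enters its view
and proposes a child of that block. -/
noncomputable def onVote (S : System f C) (p : Pid f) (t : ℝ) (q : Pid f) (τ : VoteType)
    (b : Block f C) (s : State f C) : State f C × Output f C :=
  let s₁ := { s with votes := s.votes ∪ {(q, τ, b)} }
  if S.leader (b.view + 1) = p ∧ s.view ≤ b.view ∧ 2 * f + 1 ≤ (s₁.voters τ b).card then
    propose S t
      (.byQC p (b.view + 1) (S.cmd p (b.view + 1)) b b τ (s₁.voters τ b)) s₁
  else (s₁, ∅)

open Classical in
/-- The processes from which a valid timeout message for `w` was received. -/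
noncomputable def State.tmoSenders (s : State f C) (w : ℕ) : Finset (Pid f) :=
  Finset.univ.filter fun q => s.tmos w q ≠ none

/-- The `tmo_set` formed from the received timeout messages for `w`. -/
noncomputable def State.tmoSet (s : State f C) (w : ℕ) : {q // q ∈ s.tmoSenders w} → Block f C :=
  fun q => (s.tmos w q).getD .genesis

/-- The block that a leader generates from its timeout messages for `w` on the parent `par`. -/
noncomputable def tcBlock (S : System f C) (p : Pid f) (w : ℕ) (par : Block f C)
    (s : State f C) : Block f C :=
  .byTC p (w + 1) (S.cmd p (w + 1)) par par.qc.block par.qc.type par.qc.signers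
    (par.cntTmo + 1) (s.tmoSenders w) (s.tmoSet w)

open Classical in
/-- Recording a timeout message; only the first one of a process for a view counts. -/
noncomputable def State.addTimeout (q : Pid f) (w : ℕ) (h : Block f C) (s : State f C) :
    State f C :=
  { s with tmos := fun w' q' =>
      if w' = w ∧ q' = q ∧ s.tmos w' q' = none then some h else s.tmos w' q' }

open Classical in
/-- A process that has `f + 1` timeout messages for a view that it has not left sends its own, and
with `n - f` of them, that is, with a timeout certificate, it enters the next view. If it is the
leader of the next view, it proposes a child of a highest ranked block `par` of its `tmo_set`. -/
noncomputable def onTimeout (S : System f C) (p : Pid f) (t : ℝ) (q : Pid f) (w : ℕ)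
    (h par : Block f C) (s : State f C) : State f C × Output f C :=
  if ValidTimeout S w h then
    let s₁ := s.addTimeout q w h
    if w < s.view then (s₁, ∅)
    else
      let amplify := f + 1 ≤ (s₁.tmoSenders w).card ∧ w ∉ s.timedOut
      let s₂ := if amplify then { s₁ with timedOut := s₁.timedOut ∪ {w} } else s₁
      let o₂ := if amplify then broadcast (.timeout p w s.highVote) else ∅
      if 2 * f + 1 ≤ (s₁.tmoSenders w).card then
        if S.leader (w + 1) = p then
          let r := propose S t (tcBlock S p w par s₂) s₂
          (r.1, o₂ ∪ r.2)
        else (s₂.enter S (w + 1) t, o₂)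
      else (s₂, o₂)
  else (s, ∅)

/-- `par` is a highest ranked block among the recorded timeout messages for `w`. -/
def State.IsHighest (s : State f C) (w : ℕ) (par : Block f C) : Prop :=
  (∃ q, s.tmoSet w q = par) ∧ ∀ q, ¬ (s.tmoSet w q).Outranks par

/-- The block, if there is one, by which the process entered its view (or which it received in it)
is sent along with a timeout message; this leads slower processes into that view. -/
def forward (s : State f C) : Output f C :=
  {x | ∃ b, s.current = some b ∧ x.2 = .proposal b}

open Classical in
/-- When the timer of a view expires, the process sends a timeout message for it, unless it has
already done so. -/
noncomputable def onTimer (p : Pid f) (s : State f C) : State f C × Output f C :=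
  if s.view ∈ s.timedOut then ({ s with deadline := none }, forward s)
  else ({ s with deadline := none, timedOut := s.timedOut ∪ {s.view} },
    broadcast (.timeout p s.view s.highVote) ∪ forward s)

/-- The events of an execution: nothing happens, a process starts, receives a message, or its timer
expires. -/
inductive Event (f : ℕ) (C : Type*) where
  | idle : Event f C
  | start (p : Pid f) : Event f C
  | deliver (p : Pid f) (m : Msg f C) : Event f C
  | timer (p : Pid f) : Event f C

def Event.actor : Event f C → Option (Pid f)
  | .idle => none
  | .start p => some p
  | .deliver p _ => some p
  | .timer p => some p

/-- The reactions allowed to a correct process in state `s` at time `t`: `Reaction S t e s s' o`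
says that on the event `e` it may change its state to `s'` and send `o`. The only freedom is the
choice among parents of equal rank. -/
def Reaction (S : System f C) (t : ℝ) (e : Event f C) (s s' : State f C) (o : Output f C) : Prop :=
  match e with
  | .idle => s' = s ∧ o = ∅
  | .start p => (s', o) = onStart S p t s
  | .deliver p (.proposal b) => (s', o) = onProposal S p t b s
  | .deliver p (.vote q τ b) => (s', o) = onVote S p t q τ b s
  | .deliver p (.timeout q w h) =>
      ∃ par,
        (2 * f + 1 ≤ ((s.addTimeout q w h).tmoSenders w).card →
          (s.addTimeout q w h).IsHighest w par) ∧
        (s', o) = onTimeout S p t q w h par s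
  | .timer p => (∃ d, s.deadline = some d ∧ d ≤ t) ∧ (s', o) = onTimer p s

/-- A recorded run of the system: the `k`-th event, its time, the states before the `k`-th event and
the messages sent by correct processes at the `k`-th event. -/
structure Trace (f : ℕ) (C : Type*) where
  event : ℕ → Event f C
  time : ℕ → ℝ
  state : ℕ → Pid f → State f C
  out : ℕ → Output f C

/-- The correct process `p` sent the message `m` at the `k`-th event. -/
def Trace.Sends (tr : Trace f C) (k : ℕ) (p : Pid f) (m : Msg f C) : Prop :=
  (tr.event k).actor = some p ∧ ∃ q, (q, m) ∈ tr.out k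

/-- The executions of the protocol in the partial synchrony model, in the presence of arbitrarily
behaving faulty processes. Faulty processes have no events of their own. All that they can do is to
influence which messages are received by the correct processes: these may receive any message at
any time as long as no signature of a correct process in it is forged. -/
structure IsExecution (S : System f C) (tr : Trace f C) : Prop where
  time_mono : Monotone tr.time
  time_unbounded : Filter.Tendsto tr.time Filter.atTop Filter.atTop
  initial : ∀ p, tr.state 0 p = State.initial
  /-- Local computations take no time; a step changes the state of one correct process. -/
  actor_correct : ∀ k p, (tr.event k).actor = some p → p ∈ S.correct
  step : ∀ k p, (tr.event k).actor = some p →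
    Reaction S (tr.time k) (tr.event k) (tr.state k p) (tr.state (k + 1) p) (tr.out k)
  frame : ∀ k p, (tr.event k).actor ≠ some p → tr.state (k + 1) p = tr.state k p
  idle_out : ∀ k, (tr.event k).actor = none → tr.out k = ∅
  /-- Every correct process has started when the network has become synchronous. -/
  starts : ∀ p ∈ S.correct, ∃ k, tr.event k = .start p ∧ tr.time k ≤ S.GST
  /-- Timers expire in time. -/
  timers : ∀ k, ∀ p ∈ S.correct, ∀ d, (tr.state k p).deadline = some d → tr.time k ≤ d
  /-- Messages between correct processes are received, and after `GST` with delay at most `Δ`. -/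
  delivery : ∀ j p m, p ∈ S.correct → (p, m) ∈ tr.out j →
    ∃ k, j < k ∧ tr.event k = .deliver p m ∧ tr.time k ≤ max (tr.time j) S.GST + S.Δ
  /-- A received message contains a signed statement of a correct process, at any depth, only if
  that process has sent this statement before. -/
  unforgeable : ∀ k p m, tr.event k = .deliver p m →
    ∀ m' ∈ m.statements, ∀ q ∈ S.correct, m'.signer = some q → ∃ j, j < k ∧ tr.Sends j q m'

/-- The times at which correct processes enter view `w`. -/
def entryTimes (S : System f C) (tr : Trace f C) (w : ℕ) : Set ℝ :=
  {t | ∃ k, ∃ p ∈ S.correct,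
    tr.time k = t ∧ (tr.state k p).view < w ∧ (tr.state (k + 1) p).view = w}

/-- The correct leader of view `w` proposes the block `b` in view `w`. -/
def Proposed (S : System f C) (tr : Trace f C) (w : ℕ) (b : Block f C) : Prop :=
  b.view = w ∧ b.proposer = some (S.leader w) ∧ ∃ k, tr.Sends k (S.leader w) (.proposal b)

/-- The process `p` has committed the block `b` at time `t`. -/
def CommittedBy (tr : Trace f C) (p : Pid f) (b : Block f C) (t : ℝ) : Prop :=
  ∃ k, tr.time k ≤ t ∧ b ∈ (tr.state (k + 1) p).committed

end Algorithm

end PBeeGees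

/-!
# Liveness of pBeeGees

The argument runs over the events of an execution. Two facts are used throughout. Any quorum of
`2f + 1` processes contains `f + 1` correct ones, and signatures of correct processes cannot be
forged, so a certificate carried by any block that a correct process receives shows what correct
processes have done before. And a correct process never holds sufficient evidence for sending a
timeout message or for entering the next view without having acted on it (`State.WF`).

*Progress.* Entering view `w + 1` takes certificates from view `w`, hence a correct process in view
`w`; so the first correct process to enter a view `≥ w` enters `w` itself (`FirstEntry.view_eq`).
Every view is reached (`IsExecution.exists_view_ge`): if `w` were the last one, then forwarded blocks
and amplified timeouts would bring all correct processes into `w`, all would time out, and the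
resulting timeout certificate would lead them into `w + 1`.

*Synchrony.* Let view `u` be entered first at time `t ≥ GST`, with correct leaders of `u` and `u + 1`.
Since amplification needs a correct process whose timer has expired, no correct process sends a
timeout message for a view `≥ u` before `t + 5Δ` (`FirstEntry.time_of_timeout`). If nobody left `u`,
the leader would be in `u` by `t + 2Δ`, all correct processes would vote by `t + 3Δ`, and the next
leader would have a quorum by `t + 4Δ`. So `u` is left by then, and as timeouts are excluded, it is
first left by the leader of `u + 1`, with a quorum certificate for the unique block of view `u`
(`FirstEntry.next`).

*Safety above view `v`.* This applies to `u = v`: the block of view `v + 1` certifies `B_v` by votes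
that are not prudent. At least `f + 1` correct processes vote for it (`FirstEntry.exists_voters`),
though possibly not all: a process may be carried past view `v + 1` by a certificate that others have
formed. These `f + 1` voters meet every timeout certificate for a view `≥ v + 1`, so that the parents
of all later blocks generated after timeouts have views `≥ v + 1` (`Genuine.parent_view_ge`). By
induction on the view, `B_v` lies below every valid block of a view `≥ v + 1`, and also below the
nearest block on its chain with a non-prudent certificate (`Genuine.extends`).

*Commitment.* `FirstEntry.next` for `u = v'` gives a block of view `v' + 1` with a certificate of type
`normal` for the block of view `v'`. It is delivered to everybody within `Δ`, and commits the nearest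
block with a non-prudent certificate on the chain of the block of view `v'`, which lies above `B_v`.
-/

namespace PBeeGees

variable {f : ℕ} {C : Type*}

/-! ### Validation of blocks -/

theorem explicitlyValid_of_valid_byTC {S : System f C} {i v c par qb τ Q k T high}
    (h : Valid S (.byTC i v c par qb τ Q k T high)) :
    ExplicitlyValid S (.byTC i v c par qb τ Q k T high) ∧ Valid S par := by
  unfold Valid at h ⊢
  rw [validChain] at h
  by_cases h1 : ExplicitlyValid S (.byTC i v c par qb τ Q k T high)
  · rw [if_pos h1] at h
    refine ⟨h1, fun h2 => ?_⟩
    rw [h2] at h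
    exact h rfl
  · rw [if_neg h1] at h
    exact absurd rfl h

theorem valid_byTC {S : System f C} {i v c par qb τ Q k T high}
    (h : ExplicitlyValid S (.byTC i v c par qb τ Q k T high)) (hpar : Valid S par) :
    Valid S (.byTC i v c par qb τ Q k T high) := by
  unfold Valid at hpar ⊢
  rw [validChain, if_pos h]
  cases hc : validChain S par with
  | invalid => exact absurd hc hpar
  | eqvc => simp
  | normal => dsimp only; split_ifs <;> simp

theorem valid_byQC_iff {S : System f C} {i v c par qb τ Q} :
    Valid S (.byQC i v c par qb τ Q) ↔ ExplicitlyValid S (.byQC i v c par qb τ Q) := by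
  unfold Valid
  rw [validChain]
  split_ifs with h <;> simp [h]

theorem valid_genesis (S : System f C) : Valid S .genesis := by simp [Valid, validChain]

theorem Valid.cntTmo_le {S : System f C} {b : Block f C} (h : Valid S b) : b.cntTmo ≤ S.PD := by
  cases b with
  | genesis => exact Nat.zero_le _
  | byQC => exact Nat.zero_le _
  | byTC => exact (explicitlyValid_of_valid_byTC h).1.2.2.2.2.1

/-- The block that becomes the `high_vote` after a vote for a prudent block is itself acceptable in
timeout messages. -/
theorem Valid.parent_of_prudent {S : System f C} (hPD : 1 ≤ S.PD) {b : Block f C} (h : Valid S b)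
    (hp : Prudent S b) : Valid S b.parent ∧ ¬ Prudent S b.parent ∧ b.parent.view < b.view := by
  cases b with
  | genesis => simp [Prudent, Block.cntTmo] at hp; omega
  | byQC => simp [Prudent, Block.cntTmo] at hp; omega
  | byTC i v c par qb τ Q k T high =>
    obtain ⟨h1, h2⟩ := explicitlyValid_of_valid_byTC h
    refine ⟨h2, fun h3 => ?_, h1.2.1⟩
    have h4 := h1.2.2.2.1
    change k = S.PD at hp
    change par.cntTmo = S.PD at h3
    change k = par.cntTmo + 1 at h4
    omega

theorem Valid.proposer {S : System f C} {b : Block f C} (h : Valid S b) (hb : 1 ≤ b.view) :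
    b.proposer = some (S.leader b.view) := by
  cases b with
  | genesis => simp [Block.view] at hb
  | byQC i v c par qb τ Q =>
    have := (valid_byQC_iff.1 h).1
    simp [Block.proposer, Block.view, this]
  | byTC i v c par qb τ Q k T high =>
    have := (explicitlyValid_of_valid_byTC h).1.1
    simp [Block.proposer, Block.view, this]

theorem voteType_isPrud_iff {S : System f C} {b : Block f C} :
    (voteType S b).IsPrud ↔ Prudent S b := by
  unfold voteType
  split_ifs with h <;> simp [VoteType.IsPrud, h]

/-! ### The transitions of a correct process -/

section Steps

variable {S : System f C} {p : Pid f} {t : ℝ} {s s' : State f C} {e : Event f C} {o : Output f C}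

/-- The amplification of timeouts for the view `w` by a process in state `s`, where `s₁` is the state
after recording the message received: `T` is the new value of `timedOut`, and `o` is the output. -/
def Amplifies (p : Pid f) (w : ℕ) (s s₁ : State f C) (T : Set ℕ) (o : Output f C) : Prop :=
  (f + 1 ≤ (s₁.tmoSenders w).card ∧ T = s.timedOut ∪ {w} ∧
      o = broadcast (.timeout p w s.highVote)) ∨
    ((f + 1 ≤ (s₁.tmoSenders w).card → w ∈ s.timedOut) ∧ T = s.timedOut ∧ o = ∅)

open Classical in
/-- The case distinction behind `Reaction` for the events of a process `p` at time `t` in state `s`,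
with all conditions of the handlers resolved. -/
inductive Step (S : System f C) (p : Pid f) (t : ℝ) (s : State f C) :
    Event f C → State f C → Output f C → Prop
  | restart (h : s.view ≠ 0) : Step S p t s (.start p) s ∅
  | start (h : s.view = 0) (hp : S.leader 1 ≠ p) : Step S p t s (.start p) (s.enter S 1 t) ∅
  | startLead (h : s.view = 0) (hp : S.leader 1 = p) (b : Block f C)
      (hb : b = .byQC p 1 (S.cmd p 1) .genesis .genesis .normal ∅) :
      Step S p t s (.start p) ((s.enter S b.view t).commitBy b) (broadcast (.proposal b))
  | badProposal (b : Block f C) (h : ¬ Valid S b) : Step S p t s (.deliver p (.proposal b)) s ∅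
  | oldProposal (b : Block f C) (h : Valid S b) (hv : b.view < s.view) :
      Step S p t s (.deliver p (.proposal b)) (s.commitBy b) ∅
  | noVote (b : Block f C) (h : Valid S b) (s₂ : State f C)
      (hs : (s.view < b.view ∧ s₂ = (s.commitBy b).enter S b.view t) ∨
        (s.view = b.view ∧ s₂ = s.commitBy b))
      (hn : ¬ (s.lastVoted < b.view ∧ ∀ w ∈ s.timedOut, w < b.view)) :
      Step S p t s (.deliver p (.proposal b)) { s₂ with current := some b } ∅
  | castVote (b : Block f C) (h : Valid S b) (s₂ : State f C)
      (hs : (s.view < b.view ∧ s₂ = (s.commitBy b).enter S b.view t) ∨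
        (s.view = b.view ∧ s₂ = s.commitBy b))
      (h₁ : s.lastVoted < b.view) (h₂ : ∀ w ∈ s.timedOut, w < b.view) :
      Step S p t s (.deliver p (.proposal b))
        { s₂ with
          current := some b
          lastVoted := b.view
          highVote := if Prudent S b then b.parent else b }
        {(S.leader (b.view + 1), .vote p (voteType S b) b)}
  | vote (q : Pid f) (τ : VoteType) (b : Block f C) (s₁ : State f C)
      (hs : s₁ = { s with votes := s.votes ∪ {(q, τ, b)} })
      (h : ¬ (S.leader (b.view + 1) = p ∧ s.view ≤ b.view ∧ 2 * f + 1 ≤ (s₁.voters τ b).card)) :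
      Step S p t s (.deliver p (.vote q τ b)) s₁ ∅
  | voteLead (q : Pid f) (τ : VoteType) (b : Block f C) (s₁ : State f C)
      (hs : s₁ = { s with votes := s.votes ∪ {(q, τ, b)} })
      (hp : S.leader (b.view + 1) = p) (hv : s.view ≤ b.view)
      (hc : 2 * f + 1 ≤ (s₁.voters τ b).card) (b' : Block f C)
      (hb : b' = .byQC p (b.view + 1) (S.cmd p (b.view + 1)) b b τ (s₁.voters τ b)) :
      Step S p t s (.deliver p (.vote q τ b)) ((s₁.enter S b'.view t).commitBy b')
        (broadcast (.proposal b'))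
  | badTimeout (q : Pid f) (w : ℕ) (h : Block f C) (hh : ¬ ValidTimeout S w h) :
      Step S p t s (.deliver p (.timeout q w h)) s ∅
  | oldTimeout (q : Pid f) (w : ℕ) (h : Block f C) (hh : ValidTimeout S w h) (hv : w < s.view) :
      Step S p t s (.deliver p (.timeout q w h)) (s.addTimeout q w h) ∅
  | timeout (q : Pid f) (w : ℕ) (h : Block f C) (hh : ValidTimeout S w h) (hv : s.view ≤ w)
      (s₁ : State f C) (hs : s₁ = s.addTimeout q w h) (T : Set ℕ) (o : Output f C)
      (hT : Amplifies p w s s₁ T o)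
      (hc : ¬ 2 * f + 1 ≤ (s₁.tmoSenders w).card) :
      Step S p t s (.deliver p (.timeout q w h)) { s₁ with timedOut := T } o
  | timeoutEnter (q : Pid f) (w : ℕ) (h : Block f C) (hh : ValidTimeout S w h) (hv : s.view ≤ w)
      (s₁ : State f C) (hs : s₁ = s.addTimeout q w h) (T : Set ℕ) (o : Output f C)
      (hT : Amplifies p w s s₁ T o)
      (hc : 2 * f + 1 ≤ (s₁.tmoSenders w).card) (hp : S.leader (w + 1) ≠ p) :
      Step S p t s (.deliver p (.timeout q w h))
        (State.enter S (w + 1) t { s₁ with timedOut := T }) o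
  | timeoutLead (q : Pid f) (w : ℕ) (h : Block f C) (hh : ValidTimeout S w h) (hv : s.view ≤ w)
      (s₁ : State f C) (hs : s₁ = s.addTimeout q w h) (T : Set ℕ) (o : Output f C)
      (hT : Amplifies p w s s₁ T o)
      (hc : 2 * f + 1 ≤ (s₁.tmoSenders w).card) (hp : S.leader (w + 1) = p)
      (par : Block f C) (hpar : s₁.IsHighest w par) (b : Block f C)
      (hb : b = tcBlock S p w par s₁) :
      Step S p t s (.deliver p (.timeout q w h))
        (State.commitBy b (State.enter S b.view t { s₁ with timedOut := T }))
        (o ∪ broadcast (.proposal b))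
  | timerAgain (d : ℝ) (hd : s.deadline = some d) (hdt : d ≤ t) (h : s.view ∈ s.timedOut) :
      Step S p t s (.timer p) { s with deadline := none } (forward s)
  | timer (d : ℝ) (hd : s.deadline = some d) (hdt : d ≤ t) (h : s.view ∉ s.timedOut) :
      Step S p t s (.timer p) { s with deadline := none, timedOut := s.timedOut ∪ {s.view} }
        (broadcast (.timeout p s.view s.highVote) ∪ forward s)

theorem Reaction.step (h : Reaction S t e s s' o) (he : e.actor = some p) :
    Step S p t s e s' o := by
  cases e with
  | idle => simp [Event.actor] at he
  | start p' =>
    obtain rfl : p' = p := by simpa [Event.actor] using he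
    simp only [Reaction, onStart] at h
    split_ifs at h with h1 h2
    · obtain ⟨rfl, rfl⟩ := Prod.mk.inj h
      exact .startLead h1 h2 _ rfl
    · obtain ⟨rfl, rfl⟩ := Prod.mk.inj h
      exact .start h1 h2
    · obtain ⟨rfl, rfl⟩ := Prod.mk.inj h
      exact .restart h1
  | timer p' =>
    obtain rfl : p' = p := by simpa [Event.actor] using he
    obtain ⟨⟨d, hd, hdt⟩, h⟩ := h
    simp only [onTimer] at h
    split_ifs at h with h1
    · obtain ⟨rfl, rfl⟩ := Prod.mk.inj h
      exact .timerAgain d hd hdt h1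
    · obtain ⟨rfl, rfl⟩ := Prod.mk.inj h
      exact .timer d hd hdt h1
  | deliver p' m =>
    obtain rfl : p' = p := by simpa [Event.actor] using he
    cases m with
    | proposal b =>
      simp only [Reaction, onProposal] at h
      by_cases hb : Valid S b
      swap
      · rw [if_neg hb] at h
        obtain ⟨rfl, rfl⟩ := Prod.mk.inj h
        exact .badProposal b hb
      rw [if_pos hb] at h
      by_cases hv : b.view < s.view
      · rw [if_pos hv] at h
        obtain ⟨rfl, rfl⟩ := Prod.mk.inj h
        exact .oldProposal b hb hv
      rw [if_neg hv] at h
      have hs : (s.view < b.view ∧ (if s.view < b.view then (s.commitBy b).enter S b.view t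
          else s.commitBy b) = (s.commitBy b).enter S b.view t) ∨
          (s.view = b.view ∧ (if s.view < b.view then (s.commitBy b).enter S b.view t
          else s.commitBy b) = s.commitBy b) := by
        by_cases h1 : s.view < b.view
        · exact .inl ⟨h1, if_pos h1⟩
        · exact .inr ⟨by omega, if_neg h1⟩
      by_cases hn : s.lastVoted < b.view ∧ ∀ w ∈ s.timedOut, w < b.view
      · rw [if_pos hn] at h
        obtain ⟨rfl, rfl⟩ := Prod.mk.inj h
        exact .castVote b hb _ hs hn.1 hn.2
      · rw [if_neg hn] at h
        obtain ⟨rfl, rfl⟩ := Prod.mk.inj h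
        exact .noVote b hb _ hs hn
    | vote q τ b =>
      simp only [Reaction, onVote] at h
      split_ifs at h with h1
      · obtain ⟨rfl, rfl⟩ := Prod.mk.inj h
        exact .voteLead q τ b _ rfl h1.1 h1.2.1 h1.2.2 _ rfl
      · obtain ⟨rfl, rfl⟩ := Prod.mk.inj h
        exact .vote q τ b _ rfl h1
    | timeout q w hi =>
      obtain ⟨par, hpar, h⟩ := h
      simp only [onTimeout] at h
      by_cases hb : ValidTimeout S w hi
      swap
      · rw [if_neg hb] at h
        obtain ⟨rfl, rfl⟩ := Prod.mk.inj h
        exact .badTimeout q w hi hb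
      rw [if_pos hb] at h
      by_cases hv : w < s.view
      · rw [if_pos hv] at h
        obtain ⟨rfl, rfl⟩ := Prod.mk.inj h
        exact .oldTimeout q w hi hb hv
      rw [if_neg hv] at h
      by_cases ha : f + 1 ≤ ((s.addTimeout q w hi).tmoSenders w).card ∧ w ∉ s.timedOut
      · simp only [if_pos ha] at h
        split_ifs at h with hc hp
        · obtain ⟨rfl, rfl⟩ := Prod.mk.inj h
          exact .timeoutLead q w hi hb (by omega) _ rfl (s.timedOut ∪ {w}) _
            (.inl ⟨ha.1, rfl, rfl⟩) hc hp par (hpar hc) _ rfl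
        · obtain ⟨rfl, rfl⟩ := Prod.mk.inj h
          exact .timeoutEnter q w hi hb (by omega) _ rfl (s.timedOut ∪ {w}) _
            (.inl ⟨ha.1, rfl, rfl⟩) hc hp
        · obtain ⟨rfl, rfl⟩ := Prod.mk.inj h
          exact .timeout q w hi hb (by omega) _ rfl (s.timedOut ∪ {w}) _
            (.inl ⟨ha.1, rfl, rfl⟩) hc
      · simp only [if_neg ha] at h
        have ha' : f + 1 ≤ ((s.addTimeout q w hi).tmoSenders w).card → w ∈ s.timedOut := by
          intro h1
          by_contra h2
          exact ha ⟨h1, h2⟩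
        split_ifs at h with hc hp
        · obtain ⟨rfl, rfl⟩ := Prod.mk.inj h
          exact .timeoutLead q w hi hb (by omega) _ rfl s.timedOut ∅
            (.inr ⟨ha', rfl, rfl⟩) hc hp par (hpar hc) _ rfl
        · obtain ⟨rfl, rfl⟩ := Prod.mk.inj h
          exact .timeoutEnter q w hi hb (by omega) _ rfl s.timedOut ∅
            (.inr ⟨ha', rfl, rfl⟩) hc hp
        · obtain ⟨rfl, rfl⟩ := Prod.mk.inj h
          exact .timeout q w hi hb (by omega) _ rfl s.timedOut ∅
            (.inr ⟨ha', rfl, rfl⟩) hc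

/-! ### Effects of a single step -/

theorem State.mem_tmoSenders {w : ℕ} {q : Pid f} : q ∈ s.tmoSenders w ↔ s.tmos w q ≠ none := by
  simp [State.tmoSenders]

theorem State.mem_voters {τ : VoteType} {b : Block f C} {q : Pid f} :
    q ∈ s.voters τ b ↔ (q, τ, b) ∈ s.votes := by
  simp [State.voters]

theorem State.tmos_addTimeout {q q' : Pid f} {w w' : ℕ} {h h' : Block f C}
    (hs : (s.addTimeout q w h).tmos w' q' = some h') :
    s.tmos w' q' = some h' ∨ (w' = w ∧ q' = q ∧ h' = h) := by
  simp only [State.addTimeout] at hs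
  split_ifs at hs with h1
  · exact .inr ⟨h1.1, h1.2.1, by simpa using hs.symm⟩
  · exact .inl hs

theorem State.tmos_addTimeout_mono {q q' : Pid f} {w w' : ℕ} {h : Block f C}
    (hs : s.tmos w' q' ≠ none) : (s.addTimeout q w h).tmos w' q' ≠ none := by
  simp only [State.addTimeout]
  split_ifs <;> simp_all

theorem State.tmos_addTimeout_self (q : Pid f) (w : ℕ) (h : Block f C) :
    (s.addTimeout q w h).tmos w q ≠ none := by
  simp only [State.addTimeout]
  split_ifs <;> simp_all

theorem State.tmoSenders_addTimeout_of_ne {q : Pid f} {w w' : ℕ} {h : Block f C} (hw : w' ≠ w) :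
    (s.addTimeout q w h).tmoSenders w' = s.tmoSenders w' := by
  ext q'
  simp [State.mem_tmoSenders, State.addTimeout, hw]

theorem Amplifies.subset {w s₁ T} (h : Amplifies p w s s₁ T o) : s.timedOut ⊆ T := by
  rcases h with ⟨-, rfl, -⟩ | ⟨-, rfl, -⟩
  exacts [Set.subset_union_left, subset_rfl]

theorem Amplifies.cases {w s₁ T} (h : Amplifies p w s s₁ T o) {w' : ℕ} (hw : w' ∈ T) :
    w' ∈ s.timedOut ∨ (w' = w ∧ ∀ q, (q, .timeout p w' s.highVote) ∈ o) := by
  rcases h with ⟨-, rfl, rfl⟩ | ⟨-, rfl, -⟩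
  · rcases hw with hw | rfl
    exacts [.inl hw, .inr ⟨rfl, fun q => rfl⟩]
  · exact .inl hw

theorem Amplifies.mem {w s₁ T} (h : Amplifies p w s s₁ T o)
    (hc : f + 1 ≤ (s₁.tmoSenders w).card) : w ∈ T := by
  rcases h with ⟨-, rfl, -⟩ | ⟨h1, rfl, -⟩
  exacts [.inr rfl, h1 hc]

theorem Amplifies.sent {w s₁ T} (h : Amplifies p w s s₁ T o) {q : Pid f} {m : Msg f C}
    (hm : (q, m) ∈ o) :
    m = .timeout p w s.highVote ∧ w ∈ T ∧ f + 1 ≤ (s₁.tmoSenders w).card := by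
  rcases h with ⟨h1, rfl, rfl⟩ | ⟨-, -, rfl⟩
  · exact ⟨hm, .inr rfl, h1⟩
  · exact absurd hm (Set.notMem_empty _)

theorem Step.view_mono (h : Step S p t s e s' o) : s.view ≤ s'.view := by
  cases h <;> (try rcases ‹_ ∨ _› with ⟨h1, rfl⟩ | ⟨h1, rfl⟩) <;>
    simp_all [State.enter, State.commitBy, State.addTimeout, Block.view, tcBlock] <;> omega

theorem Step.lastVoted_mono (h : Step S p t s e s' o) : s.lastVoted ≤ s'.lastVoted := by
  cases h <;> (try rcases ‹_ ∨ _› with ⟨h1, rfl⟩ | ⟨h1, rfl⟩) <;>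
    simp_all [State.enter, State.commitBy, State.addTimeout] <;> omega

theorem Step.votes_mono (h : Step S p t s e s' o) : s.votes ⊆ s'.votes := by
  cases h <;> (try rcases ‹_ ∨ _› with ⟨h1, rfl⟩ | ⟨h1, rfl⟩) <;>
    simp_all [State.enter, State.commitBy, State.addTimeout]

theorem Step.timedOut_mono (h : Step S p t s e s' o) : s.timedOut ⊆ s'.timedOut := by
  cases h <;>
    first
    | exact subset_rfl
    | exact Set.subset_union_left
    | (rcases ‹_ ∨ _› with ⟨h1, rfl⟩ | ⟨h1, rfl⟩ <;> exact subset_rfl)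
    | exact Amplifies.subset ‹_›
    | (subst_vars; exact subset_rfl)

theorem Step.tmos_mono (h : Step S p t s e s' o) {w : ℕ} {q : Pid f} (hq : s.tmos w q ≠ none) :
    s'.tmos w q ≠ none := by
  cases h <;> (try rcases ‹_ ∨ _› with ⟨h1, rfl⟩ | ⟨h1, rfl⟩) <;> subst_vars <;>
    first
    | exact hq
    | exact State.tmos_addTimeout_mono hq

theorem Step.votes_cases (h : Step S p t s e s' o) {x : Pid f × VoteType × Block f C}
    (hx : x ∈ s'.votes) : x ∈ s.votes ∨ e = .deliver p (.vote x.1 x.2.1 x.2.2) := by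
  cases h <;> (try rcases ‹_ ∨ _› with ⟨h1, rfl⟩ | ⟨h1, rfl⟩) <;> subst_vars <;>
    first
    | exact .inl hx
    | (rcases hx with hx | rfl
       · exact .inl hx
       · exact .inr rfl)

theorem Step.vote_recorded {q τ b} (h : Step S p t s (.deliver p (.vote q τ b)) s' o) :
    (q, τ, b) ∈ s'.votes := by
  cases h <;> subst_vars <;> exact .inr rfl

theorem Step.tmos_cases (h : Step S p t s e s' o) {w : ℕ} {q : Pid f} {hi : Block f C}
    (hq : s'.tmos w q = some hi) :
    s.tmos w q = some hi ∨ (e = .deliver p (.timeout q w hi) ∧ ValidTimeout S w hi) := by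
  cases h <;> (try rcases ‹_ ∨ _› with ⟨h1, rfl⟩ | ⟨h1, rfl⟩) <;> subst_vars <;>
    first
    | exact .inl hq
    | (rcases State.tmos_addTimeout hq with h2 | ⟨rfl, rfl, rfl⟩
       · exact .inl h2
       · exact .inr ⟨rfl, by assumption⟩)

theorem Step.timeout_recorded {q w hi} (h : Step S p t s (.deliver p (.timeout q w hi)) s' o)
    (hv : ValidTimeout S w hi) : s'.tmos w q ≠ none := by
  cases h <;> subst_vars <;>
    first
    | exact State.tmos_addTimeout_self q w hi
    | contradiction

theorem Step.timedOut_cases (h : Step S p t s e s' o) {w : ℕ} (hw : w ∈ s'.timedOut) :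
    w ∈ s.timedOut ∨ (s.view ≤ w ∧ ∀ q, (q, .timeout p w s.highVote) ∈ o) := by
  cases h with
  | noVote _ _ _ hs => rcases hs with ⟨-, rfl⟩ | ⟨-, rfl⟩ <;> exact .inl hw
  | castVote _ _ _ hs => rcases hs with ⟨-, rfl⟩ | ⟨-, rfl⟩ <;> exact .inl hw
  | timeout _ _ _ _ hv _ _ _ _ hT =>
    exact (hT.cases hw).imp_right fun ⟨h1, h2⟩ => ⟨h1 ▸ hv, h2⟩
  | timeoutEnter _ _ _ _ hv _ _ _ _ hT =>
    exact (hT.cases hw).imp_right fun ⟨h1, h2⟩ => ⟨h1 ▸ hv, h2⟩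
  | timeoutLead _ _ _ _ hv _ _ _ _ hT =>
    exact (hT.cases hw).imp_right fun ⟨h1, h2⟩ => ⟨h1 ▸ hv, fun q => .inl (h2 q)⟩
  | timer =>
    rcases hw with hw | rfl
    exacts [.inl hw, .inr ⟨le_rfl, fun q => .inl rfl⟩]
  | _ => subst_vars; exact .inl hw

/-- A process sends a timeout message for `w` because its timer of view `w` has expired or because
it has received such messages from `f + 1` processes. -/
theorem Step.timeout_sent (h : Step S p t s e s' o) {q p' : Pid f} {w : ℕ} {hi : Block f C}
    (hq : (q, .timeout p' w hi) ∈ o) :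
    p' = p ∧ hi = s.highVote ∧ w ∈ s'.timedOut ∧
      ((e = .timer p ∧ w = s.view ∧ ∃ d, s.deadline = some d ∧ d ≤ t) ∨
        ((∀ b, e ≠ .deliver p (.proposal b)) ∧ f + 1 ≤ (s'.tmoSenders w).card)) := by
  have key : ∀ {w' : ℕ} {s₁ : State f C} {T : Set ℕ} {o : Output f C} {b : Block f C},
      Amplifies p w' s s₁ T o → (q, Msg.timeout p' w hi) ∈ o ∪ broadcast (.proposal b) →
      p' = p ∧ hi = s.highVote ∧ w ∈ T ∧ f + 1 ≤ (s₁.tmoSenders w).card := by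
    rintro w' s₁ T o b hT (h | h)
    · obtain ⟨h1, h2, h3⟩ := hT.sent h
      cases h1
      exact ⟨rfl, rfl, h2, h3⟩
    · cases h
  cases h with
  | timer d hd hdt h =>
    rcases hq with hq | ⟨b, -, hq⟩
    · cases hq
      exact ⟨rfl, rfl, .inr rfl, .inl ⟨rfl, rfl, d, hd, hdt⟩⟩
    · cases hq
  | timerAgain =>
    obtain ⟨b, -, hq⟩ := hq
    cases hq
  | timeout _ _ _ _ _ s₁ _ T _ hT =>
    obtain ⟨h1, h2, h3, h4⟩ := key (b := .genesis) hT (.inl hq)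
    exact ⟨h1, h2, h3, .inr ⟨by simp, h4⟩⟩
  | timeoutEnter _ _ _ _ _ s₁ _ T _ hT =>
    obtain ⟨h1, h2, h3, h4⟩ := key (b := .genesis) hT (.inl hq)
    exact ⟨h1, h2, h3, .inr ⟨by simp, h4⟩⟩
  | timeoutLead _ _ _ _ _ s₁ _ T _ hT =>
    obtain ⟨h1, h2, h3, h4⟩ := key hT hq
    exact ⟨h1, h2, h3, .inr ⟨by simp, h4⟩⟩
  | _ => cases hq

/-- A process votes on receiving a valid block of a view in which it has not voted, provided that
it has not timed out in that or a later view. -/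
theorem Step.vote_sent (h : Step S p t s e s' o) {q p' : Pid f} {τ : VoteType} {b : Block f C}
    (hq : (q, .vote p' τ b) ∈ o) :
    p' = p ∧ e = .deliver p (.proposal b) ∧ Valid S b ∧ τ = voteType S b ∧ s'.view = b.view ∧
      s'.lastVoted = b.view ∧ s.lastVoted < b.view ∧ ∀ w ∈ s.timedOut, w < b.view := by
  cases h with
  | castVote b' hb s₂ hs h₁ h₂ =>
    cases hq
    refine ⟨rfl, rfl, hb, rfl, ?_, rfl, h₁, h₂⟩
    rcases hs with ⟨h1, rfl⟩ | ⟨h1, rfl⟩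
    exacts [rfl, h1]
  | timer =>
    rcases hq with hq | ⟨b, -, hq⟩ <;> cases hq
  | timerAgain =>
    obtain ⟨b, -, hq⟩ := hq
    cases hq
  | timeout _ _ _ _ _ s₁ _ T _ hT => cases (hT.sent hq).1
  | timeoutEnter _ _ _ _ _ s₁ _ T _ hT => cases (hT.sent hq).1
  | timeoutLead _ _ _ _ _ s₁ _ T _ hT =>
    rcases hq with hq | hq
    · cases (hT.sent hq).1
    · cases hq
  | _ => cases hq

theorem Step.lastVoted_cases (h : Step S p t s e s' o) :
    (s'.lastVoted = s.lastVoted ∧ s'.highVote = s.highVote) ∨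
      ∃ b, e = .deliver p (.proposal b) ∧ Valid S b ∧ s.lastVoted < b.view ∧ s'.view = b.view ∧
        s'.lastVoted = b.view ∧ (s'.highVote = b ∧ ¬ Prudent S b ∨
          s'.highVote = b.parent ∧ Prudent S b) ∧
        (S.leader (b.view + 1), .vote p (voteType S b) b) ∈ o := by
  cases h <;>
    first
    | exact .inl ⟨rfl, rfl⟩
    | (subst_vars; exact .inl ⟨rfl, rfl⟩)
    | (rcases ‹_ ∨ _› with ⟨h1, rfl⟩ | ⟨h1, rfl⟩ <;> exact .inl ⟨rfl, rfl⟩)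
    | skip
  rename_i b hb s₂ hs h1 h2
  refine .inr ⟨b, rfl, hb, h1, ?_, rfl, ?_, rfl⟩
  · rcases hs with ⟨h1, rfl⟩ | ⟨h1, rfl⟩
    · rfl
    · exact h1
  · dsimp only; split_ifs with h <;> simp [h]

theorem Step.casts_vote {b : Block f C} (h : Step S p t s (.deliver p (.proposal b)) s' o)
    (hb : Valid S b) (hv : s.view ≤ b.view) (h₁ : s.lastVoted < b.view)
    (h₂ : ∀ w ∈ s.timedOut, w < b.view) :
    (S.leader (b.view + 1), .vote p (voteType S b) b) ∈ o := by
  cases h with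
  | badProposal => contradiction
  | oldProposal => omega
  | noVote _ _ _ _ hn => exact absurd ⟨h₁, h₂⟩ hn
  | castVote => rfl

theorem Step.view_le_of_proposal {b : Block f C}
    (h : Step S p t s (.deliver p (.proposal b)) s' o) (hb : Valid S b) : b.view ≤ s'.view := by
  cases h with
  | badProposal => contradiction
  | oldProposal _ _ h => exact h.le
  | noVote _ _ _ hs => rcases hs with ⟨h1, rfl⟩ | ⟨h1, rfl⟩; exacts [le_rfl, h1.ge]
  | castVote _ _ _ hs => rcases hs with ⟨h1, rfl⟩ | ⟨h1, rfl⟩; exacts [le_rfl, h1.ge]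

theorem Step.commits_of_proposal {b : Block f C}
    (h : Step S p t s (.deliver p (.proposal b)) s' o) (hb : Valid S b) :
    newlyCommitted b ⊆ s'.committed := by
  cases h with
  | badProposal => contradiction
  | oldProposal _ _ h => exact Set.subset_union_right
  | noVote _ _ _ hs =>
    rcases hs with ⟨h1, rfl⟩ | ⟨h1, rfl⟩ <;> exact Set.subset_union_right
  | castVote _ _ _ hs =>
    rcases hs with ⟨h1, rfl⟩ | ⟨h1, rfl⟩ <;> exact Set.subset_union_right

theorem Step.deadline_cases (h : Step S p t s e s' o) :
    (s'.view = s.view ∧ s'.deadline = s.deadline) ∨ (s'.view = s.view ∧ e = .timer p) ∨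
      (s.view < s'.view ∧ s'.deadline = some (t + 5 * S.Δ)) := by
  cases h <;> (try rcases ‹_ ∨ _› with ⟨h1, rfl⟩ | ⟨h1, rfl⟩) <;>
    simp_all [State.enter, State.commitBy, State.addTimeout, Block.view, tcBlock]

theorem Step.current_cases (h : Step S p t s e s' o) {b : Block f C} (hb : s'.current = some b) :
    s.current = some b ∧ s'.view = s.view ∨
      (e = .deliver p (.proposal b) ∧ Valid S b ∧ b.view = s'.view) := by
  cases h <;> (try rcases ‹_ ∨ _› with ⟨h1, rfl⟩ | ⟨h1, rfl⟩) <;>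
    simp_all [State.enter, State.commitBy, State.addTimeout]

theorem Step.current_ne_none (h : Step S p t s e s' o) (hv : s'.view = s.view)
    (hb : s.current ≠ none) : s'.current ≠ none := by
  cases h <;> (try rcases ‹_ ∨ _› with ⟨h1, rfl⟩ | ⟨h1, rfl⟩) <;>
    simp_all [State.enter, State.commitBy, State.addTimeout, Block.view, tcBlock] <;> omega

theorem Step.forwards (h : Step S p t s (.timer p) s' o) {b : Block f C}
    (hb : s.current = some b) (q : Pid f) : (q, .proposal b) ∈ o := by
  cases h with
  | timerAgain => exact ⟨b, hb, rfl⟩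
  | timer => exact .inr ⟨b, hb, rfl⟩

theorem Step.timedOut_of_timer (h : Step S p t s (.timer p) s' o) : s.view ∈ s'.timedOut := by
  cases h with
  | timerAgain => assumption
  | timer => exact .inr rfl

theorem Step.deadline_of_timer (h : Step S p t s (.timer p) s' o) : s'.deadline = none := by
  cases h <;> rfl

theorem Step.view_pos_of_start (h : Step S p t s (.start p) s' o) : 1 ≤ s'.view := by
  cases h with
  | restart h => omega
  | start => exact le_rfl
  | startLead => subst_vars; exact le_rfl

/-! ### The local invariant and the generation of blocks -/

/-- The local invariant of a correct process `p`. The last three fields say that a process never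
waits with sufficient evidence for sending a timeout message or for entering the next view. -/
structure State.WF (S : System f C) (p : Pid f) (s : State f C) : Prop where
  high_valid : Valid S s.highVote
  high_not_prudent : ¬ Prudent S s.highVote
  high_view : s.highVote.view ≤ s.lastVoted
  voted_view : s.lastVoted ≤ s.view
  tmos_valid : ∀ w q h, s.tmos w q = some h → ValidTimeout S w h
  amplified : ∀ w, f + 1 ≤ (s.tmoSenders w).card → w < s.view ∨ w ∈ s.timedOut
  advanced : ∀ w, 2 * f + 1 ≤ (s.tmoSenders w).card → w < s.view
  certified : ∀ τ b, S.leader (b.view + 1) = p → 2 * f + 1 ≤ (s.voters τ b).card →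
    b.view < s.view

theorem State.WF.initial (hPD : 1 ≤ S.PD) : State.WF S p State.initial where
  high_valid := valid_genesis S
  high_not_prudent := by
    simp only [Prudent, State.initial, Block.cntTmo]
    omega
  high_view := le_rfl
  voted_view := le_rfl
  tmos_valid := by simp [State.initial]
  amplified := by simp [State.initial, State.tmoSenders]
  advanced := by simp [State.initial, State.tmoSenders]
  certified := by simp [State.initial, State.voters]

theorem State.WF.validTimeout (h : State.WF S p s) {w : ℕ} (hw : s.view ≤ w) :
    ValidTimeout S w s.highVote :=
  ⟨h.high_valid, h.high_not_prudent, h.high_view.trans (h.voted_view.trans hw)⟩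

theorem Step.wf (hPD : 1 ≤ S.PD) (h : Step S p t s e s' o) (hs : s.WF S p) : s'.WF S p where
  high_valid := by
    rcases h.lastVoted_cases with h1 | ⟨b, -, hb, -, -, -, h1, -⟩
    · rw [h1.2]; exact hs.high_valid
    · rcases h1 with ⟨h1, -⟩ | ⟨h1, h2⟩ <;> rw [h1]
      exacts [hb, (hb.parent_of_prudent hPD h2).1]
  high_not_prudent := by
    rcases h.lastVoted_cases with h1 | ⟨b, -, hb, -, -, -, h1, -⟩
    · rw [h1.2]; exact hs.high_not_prudent
    · rcases h1 with ⟨h1, h2⟩ | ⟨h1, h2⟩ <;> rw [h1]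
      exacts [h2, (hb.parent_of_prudent hPD h2).2.1]
  high_view := by
    rcases h.lastVoted_cases with h1 | ⟨b, -, hb, -, -, h2, h1, -⟩
    · rw [h1.1, h1.2]; exact hs.high_view
    · rcases h1 with ⟨h1, h3⟩ | ⟨h1, h3⟩ <;> rw [h1, h2]
      exact (hb.parent_of_prudent hPD h3).2.2.le
  voted_view := by
    rcases h.lastVoted_cases with h1 | ⟨b, -, -, -, h1, h2, -⟩
    · rw [h1.1]; exact hs.voted_view.trans h.view_mono
    · rw [h1, h2]
  tmos_valid w q hi hq := by
    rcases h.tmos_cases hq with h1 | h1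
    exacts [hs.tmos_valid _ _ _ h1, h1.2]
  amplified w hw := by
    have old : s'.tmoSenders w = s.tmoSenders w → w < s'.view ∨ w ∈ s'.timedOut := by
      intro h1
      rw [h1] at hw
      exact (hs.amplified w hw).imp (fun h2 => h2.trans_le h.view_mono) fun h2 => h.timedOut_mono h2
    cases h with
    | oldTimeout q w' hi hh hv =>
      rcases eq_or_ne w w' with rfl | hne
      · exact .inl hv
      · exact old (State.tmoSenders_addTimeout_of_ne hne)
    | timeout q w' hi hh hv s₁ hs₁ T _ hT hc =>
      subst hs₁
      rcases eq_or_ne w w' with rfl | hne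
      · exact .inr (hT.mem hw)
      · exact old (State.tmoSenders_addTimeout_of_ne hne)
    | timeoutEnter q w' hi hh hv s₁ hs₁ T _ hT hc =>
      subst hs₁
      rcases eq_or_ne w w' with rfl | hne
      · exact .inr (hT.mem hw)
      · exact old (State.tmoSenders_addTimeout_of_ne hne)
    | timeoutLead q w' hi hh hv s₁ hs₁ T _ hT hc =>
      subst hs₁
      rcases eq_or_ne w w' with rfl | hne
      · exact .inr (hT.mem hw)
      · exact old (State.tmoSenders_addTimeout_of_ne hne)
    | noVote _ _ _ hs => rcases hs with ⟨-, rfl⟩ | ⟨-, rfl⟩ <;> exact old rfl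
    | castVote _ _ _ hs => rcases hs with ⟨-, rfl⟩ | ⟨-, rfl⟩ <;> exact old rfl
    | _ => subst_vars; exact old rfl
  advanced w hw := by
    have old : s'.tmoSenders w = s.tmoSenders w → w < s'.view := by
      intro h1
      rw [h1] at hw
      exact (hs.advanced w hw).trans_le h.view_mono
    cases h with
    | oldTimeout q w' hi hh hv =>
      rcases eq_or_ne w w' with rfl | hne
      · exact hv
      · exact old (State.tmoSenders_addTimeout_of_ne hne)
    | timeout q w' hi hh hv s₁ hs₁ T _ hT hc =>
      subst hs₁
      rcases eq_or_ne w w' with rfl | hne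
      · exact absurd hw hc
      · exact old (State.tmoSenders_addTimeout_of_ne hne)
    | timeoutEnter q w' hi hh hv s₁ hs₁ T _ hT hc =>
      subst hs₁
      rcases eq_or_ne w w' with rfl | hne
      · exact Nat.lt_succ_self _
      · exact old (State.tmoSenders_addTimeout_of_ne hne)
    | timeoutLead q w' hi hh hv s₁ hs₁ T _ hT hc _ _ _ b hb =>
      subst hs₁ hb
      rcases eq_or_ne w w' with rfl | hne
      · exact Nat.lt_succ_self _
      · exact old (State.tmoSenders_addTimeout_of_ne hne)
    | noVote _ _ _ hs => rcases hs with ⟨-, rfl⟩ | ⟨-, rfl⟩ <;> exact old rfl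
    | castVote _ _ _ hs => rcases hs with ⟨-, rfl⟩ | ⟨-, rfl⟩ <;> exact old rfl
    | _ => subst_vars; exact old rfl
  certified τ b hp hc := by
    have old : s'.voters τ b = s.voters τ b → b.view < s'.view := by
      intro h1
      rw [h1] at hc
      exact (hs.certified τ b hp hc).trans_le h.view_mono
    have other : ∀ {q τ' b'} {s₁ : State f C},
        s₁ = { s with votes := s.votes ∪ {(q, τ', b')} } → ¬ (τ = τ' ∧ b = b') →
        s₁.voters τ b = s.voters τ b := by
      rintro q τ' b' s₁ rfl hne
      ext q'
      simp only [State.mem_voters, Set.mem_union, Set.mem_singleton_iff, Prod.mk.injEq]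
      tauto
    cases h with
    | vote q τ' b' s₁ hs₁ hn =>
      by_cases he : τ = τ' ∧ b = b'
      · obtain ⟨rfl, rfl⟩ := he
        have : s'.view = s.view := by rw [hs₁]
        by_contra h1
        exact hn ⟨hp, by omega, hc⟩
      · exact old (other hs₁ he)
    | voteLead q τ' b' s₁ hs₁ hp' hv hc' b'' hb =>
      by_cases he : τ = τ' ∧ b = b'
      · obtain ⟨rfl, rfl⟩ := he
        subst hb
        exact Nat.lt_succ_self _
      · exact old (show s₁.voters τ b = _ from other hs₁ he)
    | noVote _ _ _ hs => rcases hs with ⟨-, rfl⟩ | ⟨-, rfl⟩ <;> exact old rfl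
    | castVote _ _ _ hs => rcases hs with ⟨-, rfl⟩ | ⟨-, rfl⟩ <;> exact old rfl
    | _ => subst_vars; exact old rfl

/-- In a step from `s` to `s'` with output `o`, the process `p` enters the view of a new valid block
`b` and proposes `b`. -/
structure Generates (S : System f C) (p : Pid f) (s s' : State f C) (o : Output f C)
    (b : Block f C) : Prop where
  view_lt : s.view < b.view
  view_eq : s'.view = b.view
  proposer : b.proposer = some p
  valid : Valid S b
  sent : ∀ q, (q, .proposal b) ∈ o
  only : ∀ q b', (q, .proposal b') ∈ o → b' = b

/-- A timeout certificate of a correct process contains no prudent blocks, so the counter of a block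
on top of them does not exceed the prudence degree. -/
theorem valid_tcBlock {w : ℕ} {par : Block f C}
    (hs : ∀ q h, s.tmos w q = some h → ValidTimeout S w h)
    (hc : 2 * f + 1 ≤ (s.tmoSenders w).card) (hp : S.leader (w + 1) = p)
    (hpar : s.IsHighest w par) : Valid S (tcBlock S p w par s) := by
  obtain ⟨⟨⟨q, hq⟩, hqp⟩, hhi⟩ := hpar
  have hv : ValidTimeout S w par := by
    refine hs q par ?_
    obtain ⟨h, hh⟩ := Option.ne_none_iff_exists'.1 (State.mem_tmoSenders.1 hq)
    rw [← hqp, hh]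
    simp [State.tmoSet, hh]
  refine valid_byTC ⟨hp.symm, Nat.lt_succ_of_le hv.2.2, rfl, rfl, ?_, hc, ⟨⟨q, hq⟩, hqp⟩, hhi⟩ hv.1
  exact Nat.lt_of_le_of_ne hv.1.cntTmo_le hv.2.1

theorem Step.generates_of_start (h : Step S p t s (.start p) s' o) (hv : s'.view ≠ s.view) :
    s.view = 0 ∧ s'.view = 1 ∧ (S.leader 1 = p → ∃ b, Generates S p s s' o b) := by
  cases h with
  | restart => exact absurd rfl hv
  | start h hp => exact ⟨h, rfl, fun h1 => absurd h1 hp⟩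
  | startLead h hp b hb =>
    have hbv : b.view = 1 := by rw [hb]; rfl
    refine ⟨h, hbv, fun _ => ⟨b, by omega, rfl, by rw [hb]; rfl, ?_, fun q => rfl,
      fun q b' hq => by cases hq; rfl⟩⟩
    rw [hb, valid_byQC_iff]
    exact ⟨hp.symm, rfl, rfl, .inl rfl⟩

theorem Step.generates_of_vote {q τ b} (h : Step S p t s (.deliver p (.vote q τ b)) s' o)
    (hv : s'.view ≠ s.view) :
    s'.view = b.view + 1 ∧ S.leader (b.view + 1) = p ∧ 2 * f + 1 ≤ (s'.voters τ b).card ∧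
      ∃ b', (∃ c, b' = .byQC p (b.view + 1) c b b τ (s'.voters τ b)) ∧
        Generates S p s s' o b' := by
  cases h with
  | vote _ _ _ s₁ hs h => subst hs; exact absurd rfl hv
  | voteLead _ _ _ s₁ hs hp hv' hc b' hb =>
    have hbv : b'.view = b.view + 1 := by rw [hb]; rfl
    refine ⟨hbv, hp, hc, b', ⟨_, hb⟩, by omega, rfl, by rw [hb]; rfl, ?_,
      fun q => rfl, fun q b' hq => by cases hq; rfl⟩
    rw [hb, valid_byQC_iff]
    exact ⟨hp.symm, rfl, rfl, .inr hc⟩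

theorem Step.generates_of_timeout {q w hi} (hs : s.WF S p)
    (h : Step S p t s (.deliver p (.timeout q w hi)) s' o) (hv : s'.view ≠ s.view) :
    s'.view = w + 1 ∧ 2 * f + 1 ≤ (s'.tmoSenders w).card ∧ w ∈ s'.timedOut ∧
      (S.leader (w + 1) = p → ∃ b, Generates S p s s' o b) := by
  cases h with
  | badTimeout => exact absurd rfl hv
  | oldTimeout => exact absurd rfl hv
  | timeout _ _ _ _ _ s₁ hs => subst hs; exact absurd rfl hv
  | timeoutEnter _ _ _ _ _ s₁ hs₁ T _ hT hc hp =>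
    exact ⟨rfl, hc, hT.mem (by omega), fun h1 => absurd h1 hp⟩
  | timeoutLead _ _ _ hh hv' s₁ hs₁ T o' hT hc hp par hpar b hb =>
    have hbv : b.view = w + 1 := by rw [hb]; rfl
    refine ⟨hbv, hc, hT.mem (by omega), fun _ => ⟨b, by omega, rfl, by rw [hb]; rfl,
      ?_, fun q => .inr rfl, ?_⟩⟩
    · subst hs₁ hb
      refine valid_tcBlock (fun q' h' hq' => ?_) hc hp hpar
      rcases State.tmos_addTimeout hq' with h1 | ⟨-, -, rfl⟩
      exacts [hs.tmos_valid _ _ _ h1, hh]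
    · rintro q b' (hq | hq)
      · cases (hT.sent hq).1
      · cases hq; rfl

theorem Step.view_of_proposal {b : Block f C}
    (h : Step S p t s (.deliver p (.proposal b)) s' o) (hv : s'.view ≠ s.view) :
    Valid S b ∧ b.view = s'.view ∧ s'.current = some b := by
  cases h with
  | badProposal => exact absurd rfl hv
  | oldProposal => exact absurd rfl hv
  | noVote b hb s₂ hs =>
    rcases hs with ⟨h1, rfl⟩ | ⟨h1, rfl⟩
    exacts [⟨hb, rfl, rfl⟩, absurd rfl hv]
  | castVote b hb s₂ hs =>
    rcases hs with ⟨h1, rfl⟩ | ⟨h1, rfl⟩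
    exacts [⟨hb, rfl, rfl⟩, absurd rfl hv]

/-- The reasons for which a process can change its view. -/
theorem Step.entry_cases (hs : s.WF S p) (h : Step S p t s e s' o) (hv : s'.view ≠ s.view) :
    (e = .start p ∧ s'.view = 1 ∧ (S.leader 1 = p → ∃ b, Generates S p s s' o b)) ∨
    (∃ b, e = .deliver p (.proposal b) ∧ Valid S b ∧ b.view = s'.view ∧ s'.current = some b) ∨
    (∃ q τ b, e = .deliver p (.vote q τ b) ∧ s'.view = b.view + 1 ∧ S.leader (b.view + 1) = p ∧
      2 * f + 1 ≤ (s'.voters τ b).card ∧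
      ∃ b', (∃ c, b' = .byQC p (b.view + 1) c b b τ (s'.voters τ b)) ∧
        Generates S p s s' o b') ∨
    (∃ w, s'.view = w + 1 ∧ 2 * f + 1 ≤ (s'.tmoSenders w).card ∧ w ∈ s'.timedOut ∧
      (S.leader (w + 1) = p → ∃ b, Generates S p s s' o b)) := by
  have hact : e.actor = some p := by cases h <;> rfl
  cases e with
  | idle => cases h
  | start p' =>
    obtain rfl : p' = p := by simpa [Event.actor] using hact
    exact .inl ⟨rfl, (h.generates_of_start hv).2⟩
  | timer p' =>
    obtain rfl : p' = p := by simpa [Event.actor] using hact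
    cases h <;> exact absurd rfl hv
  | deliver p' m =>
    obtain rfl : p' = p := by simpa [Event.actor] using hact
    cases m with
    | proposal b => exact .inr (.inl ⟨b, rfl, h.view_of_proposal hv⟩)
    | vote q τ b => exact .inr (.inr (.inl ⟨q, τ, b, rfl, h.generates_of_vote hv⟩))
    | timeout q w hi => exact .inr (.inr (.inr ⟨w, h.generates_of_timeout hs hv⟩))

/-- A process sends a proposal only when it generates a block, or on forwarding a received one. -/
theorem Step.proposal_sent (hs : s.WF S p) (h : Step S p t s e s' o) {q : Pid f} {b : Block f C}
    (hq : (q, .proposal b) ∈ o) :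
    Generates S p s s' o b ∨ (e = .timer p ∧ s.current = some b) := by
  have unique : ∀ {P : Prop}, P → (P → ∃ b', Generates S p s s' o b') →
      Generates S p s s' o b := by
    intro P hP h1
    obtain ⟨b', hb'⟩ := h1 hP
    rwa [hb'.only q b hq]
  cases h with
  | startLead h hp b' hb =>
    subst hb
    exact .inl (unique hp ((Step.startLead (t := t) h hp _ rfl).generates_of_start
      (by simp only [h]; exact one_ne_zero)).2.2)
  | voteLead q' τ b' s₁ hs₁ hp hv hc b'' hb =>
    subst hb
    obtain ⟨-, -, -, b₁, -, h1⟩ := (Step.voteLead (t := t) q' τ b' s₁ hs₁ hp hv hc _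
      rfl).generates_of_vote (by change b'.view + 1 ≠ s.view; omega)
    exact .inl (unique trivial fun _ => ⟨b₁, h1⟩)
  | timeoutLead q' w hi hh hv s₁ hs₁ T o' hT hc hp par hpar b' hb =>
    subst hb
    exact .inl (unique hp ((Step.timeoutLead (t := t) q' w hi hh hv s₁ hs₁ T o' hT hc hp par hpar _
      rfl).generates_of_timeout hs (by change w + 1 ≠ s.view; omega)).2.2.2)
  | castVote => cases hq
  | timeout _ _ _ _ _ s₁ _ T _ hT => cases (hT.sent hq).1
  | timeoutEnter _ _ _ _ _ s₁ _ T _ hT => cases (hT.sent hq).1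
  | timerAgain =>
    obtain ⟨b', hb, hq⟩ := hq
    cases hq
    exact .inr ⟨rfl, hb⟩
  | timer =>
    rcases hq with hq | ⟨b', hb, hq⟩
    · cases hq
    · cases hq
      exact .inr ⟨rfl, hb⟩
  | _ => cases hq

end Steps

/-! ### Quorums -/

theorem card_correct {S : System f C} (hfaulty : S.correctᶜ.card ≤ f) :
    2 * f + 1 ≤ S.correct.card := by
  have h := Finset.card_add_card_compl S.correct
  rw [Fintype.card_fin] at h
  omega

theorem card_inter_correct {S : System f C} (hfaulty : S.correctᶜ.card ≤ f)
    {Q : Finset (Pid f)} (hQ : 2 * f + 1 ≤ Q.card) :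
    f + 1 ≤ (Q ∩ S.correct).card := by
  have h := Finset.card_inter_add_card_union Q S.correct
  have h1 := card_correct hfaulty
  have h2 := Finset.card_le_univ (Q ∪ S.correct)
  rw [Fintype.card_fin] at h2
  omega

theorem exists_correct {S : System f C} (hfaulty : S.correctᶜ.card ≤ f)
    {Q : Finset (Pid f)} (hQ : f + 1 ≤ Q.card) : ∃ q ∈ Q, q ∈ S.correct := by
  by_contra! h
  have : Q ⊆ S.correctᶜ := fun q hq => Finset.mem_compl.2 (h q hq)
  have := Finset.card_le_card this
  omega

theorem exists_mem_of_quorums {Q V : Finset (Pid f)} (hQ : 2 * f + 1 ≤ Q.card)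
    (hV : f + 1 ≤ V.card) : ∃ q ∈ Q, q ∈ V := by
  have h := Finset.card_inter_add_card_union Q V
  have h2 := Finset.card_le_univ (Q ∪ V)
  rw [Fintype.card_fin] at h2
  obtain ⟨q, hq⟩ := Finset.card_pos.1 (show 0 < (Q ∩ V).card by omega)
  exact ⟨q, Finset.mem_inter.1 hq⟩

/-! ### Executions: what the state of a process says about the past -/

section Executions

variable {S : System f C} {tr : Trace f C}

theorem IsExecution.step_or_eq (hx : IsExecution S tr) (k : ℕ) (p : Pid f) :
    tr.state (k + 1) p = tr.state k p ∨ ((tr.event k).actor = some p ∧ p ∈ S.correct ∧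
      Step S p (tr.time k) (tr.state k p) (tr.event k) (tr.state (k + 1) p) (tr.out k)) := by
  by_cases h : (tr.event k).actor = some p
  · exact .inr ⟨h, hx.actor_correct k p h, (hx.step k p h).step h⟩
  · exact .inl (hx.frame k p h)

theorem IsExecution.view_mono (hx : IsExecution S tr) (p : Pid f) :
    Monotone fun k => (tr.state k p).view := by
  refine monotone_nat_of_le_succ fun k => ?_
  rcases hx.step_or_eq k p with h | ⟨-, -, h⟩
  exacts [h ▸ le_rfl, h.view_mono]

theorem IsExecution.lastVoted_mono (hx : IsExecution S tr) (p : Pid f) :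
    Monotone fun k => (tr.state k p).lastVoted := by
  refine monotone_nat_of_le_succ fun k => ?_
  rcases hx.step_or_eq k p with h | ⟨-, -, h⟩
  exacts [h ▸ le_rfl, h.lastVoted_mono]

theorem IsExecution.votes_mono (hx : IsExecution S tr) (p : Pid f) :
    Monotone fun k => (tr.state k p).votes := by
  refine monotone_nat_of_le_succ fun k => ?_
  rcases hx.step_or_eq k p with h | ⟨-, -, h⟩
  exacts [h ▸ le_rfl, h.votes_mono]

theorem IsExecution.timedOut_mono (hx : IsExecution S tr) (p : Pid f) :
    Monotone fun k => (tr.state k p).timedOut := by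
  refine monotone_nat_of_le_succ fun k => ?_
  rcases hx.step_or_eq k p with h | ⟨-, -, h⟩
  exacts [h ▸ le_rfl, h.timedOut_mono]

theorem IsExecution.tmoSenders_mono (hx : IsExecution S tr) (p : Pid f) (w : ℕ) :
    Monotone fun k => (tr.state k p).tmoSenders w := by
  refine monotone_nat_of_le_succ fun k => ?_
  rcases hx.step_or_eq k p with h | ⟨-, -, h⟩
  · exact h ▸ le_rfl
  · intro q hq
    exact State.mem_tmoSenders.2 (h.tmos_mono (State.mem_tmoSenders.1 hq))

theorem IsExecution.wf (hx : IsExecution S tr) (hPD : 1 ≤ S.PD) (k : ℕ) (p : Pid f) :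
    (tr.state k p).WF S p := by
  induction k with
  | zero => rw [hx.initial]; exact .initial hPD
  | succ k ih =>
    rcases hx.step_or_eq k p with h | ⟨-, -, h⟩
    exacts [h ▸ ih, h.wf hPD ih]

theorem IsExecution.step_of_sends (hx : IsExecution S tr) {k : ℕ} {p : Pid f} {m : Msg f C}
    (h : tr.Sends k p m) : p ∈ S.correct ∧
      Step S p (tr.time k) (tr.state k p) (tr.event k) (tr.state (k + 1) p) (tr.out k) ∧
      ∃ q, (q, m) ∈ tr.out k :=
  ⟨hx.actor_correct k p h.1, (hx.step k p h.1).step h.1, h.2⟩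

theorem IsExecution.step_of_deliver (hx : IsExecution S tr) {k : ℕ} {p : Pid f} {m : Msg f C}
    (h : tr.event k = .deliver p m) :
    Step S p (tr.time k) (tr.state k p) (.deliver p m) (tr.state (k + 1) p) (tr.out k) := by
  have h1 : (tr.event k).actor = some p := by rw [h]; rfl
  exact h ▸ (hx.step k p h1).step h1

/-- A timeout message of a correct process that was recorded before the `k`-th event was sent. -/
theorem IsExecution.tmos_sent (hx : IsExecution S tr) {k : ℕ} {p q : Pid f} {w : ℕ}
    {h : Block f C} (hq : q ∈ S.correct) (hs : (tr.state k p).tmos w q = some h) :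
    ∃ j, j + 1 < k ∧ tr.Sends j q (.timeout q w h) := by
  induction k with
  | zero => simp [hx.initial, State.initial] at hs
  | succ k ih =>
    have old : (tr.state k p).tmos w q = some h →
        ∃ j, j + 1 < k + 1 ∧ tr.Sends j q (.timeout q w h) := fun h1 => by
      obtain ⟨j, hj, h2⟩ := ih h1
      exact ⟨j, by omega, h2⟩
    rcases hx.step_or_eq k p with h1 | ⟨-, -, h1⟩
    · exact old (h1 ▸ hs)
    · rcases h1.tmos_cases hs with h2 | ⟨h2, -⟩
      · exact old h2
      · obtain ⟨j, hj, h3⟩ := hx.unforgeable k p _ h2 _ (.inl rfl) q hq rfl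
        exact ⟨j, by omega, h3⟩

theorem IsExecution.votes_sent (hx : IsExecution S tr) {k : ℕ} {p q : Pid f} {τ : VoteType}
    {b : Block f C} (hq : q ∈ S.correct) (hs : (q, τ, b) ∈ (tr.state k p).votes) :
    ∃ j, j + 1 < k ∧ tr.Sends j q (.vote q τ b) := by
  induction k with
  | zero => simp [hx.initial, State.initial] at hs
  | succ k ih =>
    have old : (q, τ, b) ∈ (tr.state k p).votes →
        ∃ j, j + 1 < k + 1 ∧ tr.Sends j q (.vote q τ b) := fun h1 => by
      obtain ⟨j, hj, h2⟩ := ih h1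
      exact ⟨j, by omega, h2⟩
    rcases hx.step_or_eq k p with h1 | ⟨-, -, h1⟩
    · exact old (h1 ▸ hs)
    · rcases h1.votes_cases hs with h2 | h2
      · exact old h2
      · obtain ⟨j, hj, h3⟩ := hx.unforgeable k p _ h2 _ (.inl rfl) q hq rfl
        exact ⟨j, by omega, h3⟩

/-- A view counts as timed out only after an acceptable timeout message has been broadcast. -/
theorem IsExecution.timedOut_sent (hx : IsExecution S tr) (hPD : 1 ≤ S.PD) {k : ℕ} {p : Pid f}
    {w : ℕ} (hw : w ∈ (tr.state k p).timedOut) :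
    ∃ j h, j < k ∧ (tr.event j).actor = some p ∧ ValidTimeout S w h ∧
      ∀ q, (q, .timeout p w h) ∈ tr.out j := by
  induction k with
  | zero => simp [hx.initial, State.initial] at hw
  | succ k ih =>
    have old : w ∈ (tr.state k p).timedOut → ∃ j h, j < k + 1 ∧ (tr.event j).actor = some p ∧
        ValidTimeout S w h ∧ ∀ q, (q, .timeout p w h) ∈ tr.out j := fun h1 => by
      obtain ⟨j, h, hj, h2⟩ := ih h1
      exact ⟨j, h, by omega, h2⟩
    rcases hx.step_or_eq k p with h1 | ⟨h0, -, h1⟩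
    · exact old (h1 ▸ hw)
    · rcases h1.timedOut_cases hw with h2 | ⟨h2, h3⟩
      · exact old h2
      · exact ⟨k, _, by omega, h0, (hx.wf hPD k p).validTimeout h2, h3⟩

theorem IsExecution.current_received (hx : IsExecution S tr) {k : ℕ} {p : Pid f} {b : Block f C}
    (hb : (tr.state k p).current = some b) :
    Valid S b ∧ b.view = (tr.state k p).view ∧
      ∃ j < k, tr.event j = .deliver p (.proposal b) := by
  induction k with
  | zero => simp [hx.initial, State.initial] at hb
  | succ k ih =>
    rcases hx.step_or_eq k p with h1 | ⟨-, -, h1⟩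
    · rw [h1] at hb ⊢
      obtain ⟨h2, h3, j, hj, h4⟩ := ih hb
      exact ⟨h2, h3, j, by omega, h4⟩
    · rcases h1.current_cases hb with ⟨h2, h3⟩ | ⟨h2, h3, h4⟩
      · obtain ⟨h5, h6, j, hj, h7⟩ := ih h2
        exact ⟨h5, h6.trans h3.symm, j, by omega, h7⟩
      · exact ⟨h3, h4, k, by omega, h2⟩

/-- A running timer was started on entering the current view. -/
theorem IsExecution.deadline_eq (hx : IsExecution S tr) {k : ℕ} {p : Pid f} {d : ℝ}
    (hd : (tr.state k p).deadline = some d) :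
    ∃ i < k, (tr.state (i + 1) p).view = (tr.state k p).view ∧ d = tr.time i + 5 * S.Δ := by
  induction k with
  | zero => simp [hx.initial, State.initial] at hd
  | succ k ih =>
    rcases hx.step_or_eq k p with h1 | ⟨-, -, h1⟩
    · rw [h1] at hd ⊢
      obtain ⟨i, hi, h2⟩ := ih hd
      exact ⟨i, by omega, h2⟩
    · rcases h1.deadline_cases with ⟨h2, h3⟩ | ⟨h2, h3⟩ | ⟨-, h3⟩
      · obtain ⟨i, hi, h4, h5⟩ := ih (h3 ▸ hd)
        exact ⟨i, by omega, h4.trans h2.symm, h5⟩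
      · rw [h3] at h1
        simp [h1.deadline_of_timer] at hd
      · rw [h3] at hd
        exact ⟨k, by omega, rfl, (Option.some.inj hd).symm⟩

/-- Amplification alone never starts a timeout: behind every timeout message of a correct process
for view `w` there is an expired timer of a correct process in view `w`. -/
theorem IsExecution.timeout_origin (hx : IsExecution S tr) (hfaulty : S.correctᶜ.card ≤ f)
    {k : ℕ} {p : Pid f} {w : ℕ} {h : Block f C} (hs : tr.Sends k p (.timeout p w h)) :
    ∃ j ≤ k, ∃ q ∈ S.correct, (tr.state j q).view = w ∧
      ∃ d, (tr.state j q).deadline = some d ∧ d ≤ tr.time j := by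
  induction k using Nat.strong_induction_on generalizing p h with
  | _ k ih =>
    obtain ⟨hp, h1, q, hq⟩ := hx.step_of_sends hs
    obtain ⟨-, -, -, ⟨-, rfl, h2⟩ | ⟨-, h2⟩⟩ := h1.timeout_sent hq
    · exact ⟨k, le_rfl, p, hp, rfl, h2⟩
    · obtain ⟨q', h3, h4⟩ := exists_correct hfaulty h2
      obtain ⟨h', h5⟩ := Option.ne_none_iff_exists'.1 (State.mem_tmoSenders.1 h3)
      obtain ⟨j, hj, h6⟩ := hx.tmos_sent h4 h5
      obtain ⟨i, hi, h7⟩ := ih j (by omega) h6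
      exact ⟨i, by omega, h7⟩

/-! ### Blocks that contain no forged signatures -/

/-- All signed statements of correct processes in the block `b` have been sent before the `k`-th
event. -/
def Genuine (S : System f C) (tr : Trace f C) (k : ℕ) (b : Block f C) : Prop :=
  ∀ m ∈ b.statements, ∀ q ∈ S.correct, m.signer = some q → ∃ j < k, tr.Sends j q m

theorem IsExecution.genuine_of_deliver (hx : IsExecution S tr) {k : ℕ} {p : Pid f} {b : Block f C}
    (h : tr.event k = .deliver p (.proposal b)) : Genuine S tr k b :=
  hx.unforgeable k p _ h

theorem Genuine.mono {k k' : ℕ} {b : Block f C} (h : Genuine S tr k b) (hk : k ≤ k') :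
    Genuine S tr k' b := fun m hm q hq hs => by
  obtain ⟨j, hj, h1⟩ := h m hm q hq hs
  exact ⟨j, by omega, h1⟩

/-- The process `p` generates the block `b` at the `k`-th event. -/
def GeneratedAt (S : System f C) (tr : Trace f C) (k : ℕ) (p : Pid f) (b : Block f C) : Prop :=
  (tr.event k).actor = some p ∧ Generates S p (tr.state k p) (tr.state (k + 1) p) (tr.out k) b

/-- A block that a correct process proposes under its own name is one that it has generated; when it
forwards such a block, it has received its own signature. -/
theorem IsExecution.generated_of_sends (hx : IsExecution S tr) (hPD : 1 ≤ S.PD) {k : ℕ} {p : Pid f}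
    {b : Block f C} (hs : tr.Sends k p (.proposal b)) (hb : b.proposer = some p) :
    ∃ j ≤ k, GeneratedAt S tr j p b := by
  induction k using Nat.strong_induction_on with
  | _ k ih =>
    obtain ⟨hp, h1, q, hq⟩ := hx.step_of_sends hs
    rcases h1.proposal_sent (hx.wf hPD k p) hq with h2 | ⟨-, h2⟩
    · exact ⟨k, le_rfl, hs.1, h2⟩
    · obtain ⟨-, -, j, hj, h3⟩ := hx.current_received h2
      have hm : Msg.proposal b ∈ b.statements := by
        cases b with
        | genesis => simp [Block.proposer] at hb
        | byQC => exact .inl (.inl (.inl rfl))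
        | byTC => exact .inl (.inl (.inl (.inl (.inl rfl))))
      obtain ⟨i, hi, h4⟩ := hx.unforgeable j p _ h3 _ hm p hp hb
      obtain ⟨i', hi', h5⟩ := ih i (by omega) h4
      exact ⟨i', by omega, h5⟩

/-- A block that is valid for a view of a correct leader has been generated by that leader. -/
theorem Genuine.generated (hx : IsExecution S tr) (hPD : 1 ≤ S.PD) {k : ℕ} {b : Block f C}
    (h : Genuine S tr k b) (hb : Valid S b) (hv : 1 ≤ b.view) (hl : S.leader b.view ∈ S.correct) :
    ∃ j < k, GeneratedAt S tr j (S.leader b.view) b := by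
  have hm : Msg.proposal b ∈ b.statements := by
    cases b with
    | genesis => simp [Block.view] at hv
    | byQC => exact .inl (.inl (.inl rfl))
    | byTC => exact .inl (.inl (.inl (.inl (.inl rfl))))
  obtain ⟨i, hi, h1⟩ := h _ hm _ hl (hb.proposer hv)
  obtain ⟨j, hj, h2⟩ := hx.generated_of_sends hPD h1 (hb.proposer hv)
  exact ⟨j, by omega, h2⟩

/-- A correct process generates at most one block for each view. -/
theorem IsExecution.generated_unique (hx : IsExecution S tr) {j j' : ℕ} {p : Pid f}
    {b b' : Block f C} (h : GeneratedAt S tr j p b) (h' : GeneratedAt S tr j' p b')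
    (hv : b.view = b'.view) : b = b' := by
  have key : ∀ {j j' : ℕ} {b b' : Block f C}, GeneratedAt S tr j p b → GeneratedAt S tr j' p b' →
      b.view = b'.view → ¬ j < j' := by
    intro j j' b b' h h' hv hlt
    have h1 := hx.view_mono p (show j + 1 ≤ j' from hlt)
    dsimp only at h1
    have := h.2.view_eq
    have := h'.2.view_lt
    omega
  -- Generating a block raises the view to that of the block, so both are generated at one event.
  obtain rfl : j = j' := by
    have := key h h' hv
    have := key h' h hv.symm
    omega
  exact h'.2.only p b (h.2.sent p)

/-- A correct leader has a block of its own in every view that it enters. -/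
theorem IsExecution.leader_generates (hx : IsExecution S tr) (hPD : 1 ≤ S.PD) {k w : ℕ}
    (hl : S.leader w ∈ S.correct) (hw : 1 ≤ w) (hv : (tr.state k (S.leader w)).view = w) :
    ∃ j < k, ∃ b, b.view = w ∧ GeneratedAt S tr j (S.leader w) b := by
  induction k with
  | zero =>
    rw [hx.initial] at hv
    change 0 = w at hv
    omega
  | succ k ih =>
    by_cases hv' : (tr.state k (S.leader w)).view = w
    · obtain ⟨j, hj, h⟩ := ih hv'
      exact ⟨j, by omega, h⟩
    rcases hx.step_or_eq k (S.leader w) with h1 | ⟨h0, -, h1⟩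
    · exact absurd (h1 ▸ hv) hv'
    have now : ∀ b, Generates S (S.leader w) (tr.state k (S.leader w))
        (tr.state (k + 1) (S.leader w)) (tr.out k) b →
        ∃ j < k + 1, ∃ b, b.view = w ∧ GeneratedAt S tr j (S.leader w) b := fun b hb =>
      ⟨k, by omega, b, hb.view_eq.symm.trans hv, h0, hb⟩
    rcases h1.entry_cases (hx.wf hPD k _) (by omega) with
      ⟨-, h2, h3⟩ | ⟨b, h2, h3, h4, -⟩ | ⟨q, τ, b, -, -, -, -, b', -, h3⟩ | ⟨w', h2, -, -, h3⟩
    · obtain ⟨b, hb⟩ := h3 (by rw [← h2, hv])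
      exact now b hb
    · rw [hv] at h4
      obtain ⟨j, hj, h5⟩ := (hx.genuine_of_deliver h2).generated hx hPD h3 (by omega)
        (by rwa [h4])
      exact ⟨j, by omega, b, h4, by rwa [h4] at h5⟩
    · exact now b' h3
    · obtain ⟨b, hb⟩ := h3 (by rw [← h2, hv])
      exact now b hb

/-! ### Evidence for entering a view -/

/-- The votes of the quorum `Q` for `b`, as far as they are votes of correct processes, have been
sent before the `k`-th event. -/
def VoteEvidence (S : System f C) (tr : Trace f C) (k : ℕ) (b : Block f C) (τ : VoteType)
    (Q : Finset (Pid f)) : Prop :=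
  2 * f + 1 ≤ Q.card ∧ ∀ q ∈ Q, q ∈ S.correct → ∃ j < k, tr.Sends j q (.vote q τ b)

/-- The timeout messages of the quorum `Q` for view `w`, as far as they are messages of correct
processes, have been sent before the `k`-th event. -/
def TimeoutEvidence (S : System f C) (tr : Trace f C) (k w : ℕ) (Q : Finset (Pid f)) : Prop :=
  2 * f + 1 ≤ Q.card ∧ ∀ q ∈ Q, q ∈ S.correct → ∃ j < k, ∃ h, tr.Sends j q (.timeout q w h)

theorem Genuine.of_byQC {k i v c par qb τ Q} (h : Genuine S tr k (.byQC i v c par qb τ Q))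
    (hb : Valid S (.byQC i v c par qb τ Q)) :
    qb = par ∧ v = qb.view + 1 ∧ (qb = .genesis ∨ VoteEvidence S tr k qb τ Q) := by
  obtain ⟨-, h2, h3, h4⟩ := valid_byQC_iff.1 hb
  refine ⟨h3, h2, h4.imp_right fun h5 => ⟨h5, fun q hq hq' => ?_⟩⟩
  exact h (.vote q τ qb) (.inr ⟨q, hq, rfl⟩) q hq' rfl

theorem Genuine.of_byTC {k i v c par qb τ Q n T high}
    (h : Genuine S tr k (.byTC i v c par qb τ Q n T high))
    (hb : Valid S (.byTC i v c par qb τ Q n T high)) :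
    Genuine S tr k par ∧ Valid S par ∧ ∃ w, v = w + 1 ∧
      ∀ q : {q // q ∈ T}, q.1 ∈ S.correct → ∃ j < k, tr.Sends j q (.timeout q w (high q)) := by
  obtain ⟨h1, h2⟩ := explicitlyValid_of_valid_byTC hb
  refine ⟨fun m hm => h m (.inl (.inl (.inl (.inl (.inr hm))))), h2, v - 1, ?_, ?_⟩
  · have := h1.2.1
    omega
  · intro q hq
    refine h (.timeout q (v - 1) (high q)) (.inl (.inr ⟨q, v - 1, ?_, rfl⟩)) q hq rfl
    have := h1.2.1
    omega

theorem IsExecution.of_vote (hx : IsExecution S tr) {k : ℕ} {p : Pid f} {τ : VoteType}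
    {b : Block f C} (h : tr.Sends k p (.vote p τ b)) :
    tr.event k = .deliver p (.proposal b) ∧ Genuine S tr k b ∧ Valid S b ∧ τ = voteType S b ∧
      1 ≤ b.view ∧ (tr.state (k + 1) p).view = b.view ∧
      (tr.state (k + 1) p).lastVoted = b.view ∧
      ∀ w ∈ (tr.state k p).timedOut, w < b.view := by
  obtain ⟨hp, h1, q, hq⟩ := hx.step_of_sends h
  obtain ⟨-, h2, h3, h4, h5, h6, h7, h8⟩ := h1.vote_sent hq
  exact ⟨h2, hx.genuine_of_deliver h2, h3, h4, by omega, h5, h6, h8⟩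

/-- What is certified by a quorum has been validated by a correct process. -/
theorem VoteEvidence.block (hx : IsExecution S tr) (hfaulty : S.correctᶜ.card ≤ f) {k : ℕ}
    {b : Block f C} {τ : VoteType} {Q : Finset (Pid f)} (h : VoteEvidence S tr k b τ Q) :
    Genuine S tr k b ∧ Valid S b ∧ τ = voteType S b ∧ 1 ≤ b.view ∧
      ∃ j ≤ k, ∃ q ∈ S.correct, (tr.state j q).view = b.view := by
  obtain ⟨q, hq, hq'⟩ := exists_correct hfaulty (show f + 1 ≤ Q.card by have := h.1; omega)
  obtain ⟨j, hj, h1⟩ := h.2 q hq hq'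
  obtain ⟨-, h2, h3, h4, h5, h6, -⟩ := hx.of_vote h1
  exact ⟨h2.mono hj.le, h3, h4, h5, j + 1, hj, q, hq', h6⟩

theorem TimeoutEvidence.sent (hfaulty : S.correctᶜ.card ≤ f) {k w : ℕ} {Q : Finset (Pid f)}
    (h : TimeoutEvidence S tr k w Q) :
    ∃ j < k, ∃ q h, tr.Sends j q (.timeout q w h) := by
  obtain ⟨q, hq, hq'⟩ := exists_correct hfaulty (show f + 1 ≤ Q.card by have := h.1; omega)
  obtain ⟨j, hj, h', h1⟩ := h.2 q hq hq'
  exact ⟨j, hj, q, h', h1⟩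

theorem IsExecution.voteEvidence_of_voters (hx : IsExecution S tr) {k : ℕ} {p : Pid f}
    {τ : VoteType} {b : Block f C}
    (h : 2 * f + 1 ≤ ((tr.state (k + 1) p).voters τ b).card) :
    VoteEvidence S tr k b τ ((tr.state (k + 1) p).voters τ b) := by
  refine ⟨h, fun q hq hq' => ?_⟩
  obtain ⟨j, hj, h1⟩ := hx.votes_sent hq' (State.mem_voters.1 hq)
  exact ⟨j, by omega, h1⟩

theorem IsExecution.timeoutEvidence_of_tmoSenders (hx : IsExecution S tr) {k w : ℕ} {p : Pid f}
    (h : 2 * f + 1 ≤ ((tr.state (k + 1) p).tmoSenders w).card) :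
    TimeoutEvidence S tr k w ((tr.state (k + 1) p).tmoSenders w) := by
  refine ⟨h, fun q hq hq' => ?_⟩
  obtain ⟨hi, h0⟩ := Option.ne_none_iff_exists'.1 (State.mem_tmoSenders.1 hq)
  obtain ⟨j, hj, h1⟩ := hx.tmos_sent hq' h0
  exact ⟨j, by omega, hi, h1⟩

/-- A process that enters a view other than view `1` has evidence from the preceding view. -/
theorem IsExecution.entry_evidence (hx : IsExecution S tr) (hPD : 1 ≤ S.PD) {k : ℕ} {p : Pid f}
    (h : (tr.state (k + 1) p).view ≠ (tr.state k p).view) :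
    (tr.state (k + 1) p).view = 1 ∨
    (∃ b τ Q, VoteEvidence S tr k b τ Q ∧ (tr.state (k + 1) p).view = b.view + 1) ∨
    (∃ w Q, TimeoutEvidence S tr k w Q ∧ (tr.state (k + 1) p).view = w + 1) := by
  rcases hx.step_or_eq k p with h1 | ⟨-, -, h1⟩
  · exact absurd (by rw [h1]) h
  rcases h1.entry_cases (hx.wf hPD k p) h with
    ⟨-, h2, -⟩ | ⟨b, h2, h3, h4, -⟩ | ⟨q, τ, b, -, h2, -, h3, -⟩ | ⟨w, h2, h3, -⟩
  · exact .inl h2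
  · have hg := hx.genuine_of_deliver h2
    cases b with
    | genesis =>
      have := h1.view_mono
      change 0 = _ at h4
      omega
    | byQC i v c par qb τ Q =>
      obtain ⟨-, h5, rfl | h6⟩ := hg.of_byQC h3
      · exact .inl (h4.symm.trans h5)
      · exact .inr (.inl ⟨qb, τ, Q, h6, h4.symm.trans h5⟩)
    | byTC i v c par qb τ Q n T high =>
      obtain ⟨-, -, w, h5, h6⟩ := hg.of_byTC h3
      refine .inr (.inr ⟨w, T, ⟨(explicitlyValid_of_valid_byTC h3).1.2.2.2.2.2.1, fun q hq hq' => ?_⟩,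
        h4.symm.trans h5⟩)
      obtain ⟨j, hj, h7⟩ := h6 ⟨q, hq⟩ hq'
      exact ⟨j, hj, _, h7⟩
  · exact .inr (.inl ⟨b, τ, _, hx.voteEvidence_of_voters h3, h2⟩)
  · exact .inr (.inr ⟨w, _, hx.timeoutEvidence_of_tmoSenders h3, h2⟩)

/-- At the `k`-th event `p` is the first correct process to enter a view `≥ w`. -/
structure FirstEntry (S : System f C) (tr : Trace f C) (w k : ℕ) (p : Pid f) : Prop where
  correct : p ∈ S.correct
  before : ∀ j ≤ k, ∀ q ∈ S.correct, (tr.state j q).view < w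
  entry : w ≤ (tr.state (k + 1) p).view

theorem FirstEntry.view_ne {w k : ℕ} {p : Pid f} (h : FirstEntry S tr w k p) :
    (tr.state (k + 1) p).view ≠ (tr.state k p).view := by
  have := h.before k le_rfl p h.correct
  have := h.entry
  omega

/-- Views cannot be skipped by all correct processes. -/
theorem FirstEntry.view_eq (hx : IsExecution S tr) (hPD : 1 ≤ S.PD)
    (hfaulty : S.correctᶜ.card ≤ f) {w k : ℕ} {p : Pid f} (hw : 1 ≤ w)
    (h : FirstEntry S tr w k p) : (tr.state (k + 1) p).view = w := by
  have he := h.entry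
  rcases hx.entry_evidence hPD h.view_ne with h1 | ⟨b, τ, Q, h1, h2⟩ | ⟨u, Q, h1, h2⟩
  · omega
  · obtain ⟨-, -, -, -, j, hj, q, hq, h3⟩ := h1.block hx hfaulty
    have := h.before j hj q hq
    omega
  · obtain ⟨j, hj, q, hi, h3⟩ := h1.sent hfaulty
    obtain ⟨i, hi, q', hq', h4, -⟩ := hx.timeout_origin hfaulty h3
    have := h.before i (by omega) q' hq'
    omega

theorem IsExecution.exists_firstEntry (hx : IsExecution S tr) {w : ℕ} (hw : 1 ≤ w)
    (h : ∃ k, ∃ p ∈ S.correct, w ≤ (tr.state k p).view) : ∃ k p, FirstEntry S tr w k p := by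
  classical
  obtain ⟨p, hp, h1⟩ := Nat.find_spec h
  have hmin := fun j hj => Nat.find_min (m := j) h hj
  cases hk : Nat.find h with
  | zero =>
    rw [hk, hx.initial] at h1
    change w ≤ 0 at h1
    omega
  | succ k =>
    rw [hk] at h1 hmin
    refine ⟨k, p, hp, fun j hj q hq => ?_, h1⟩
    have h2 := hmin j (by omega)
    push Not at h2
    exact h2 q hq

/-- Correct processes do not time out before `5Δ` have passed since the first entry. -/
theorem FirstEntry.time_of_timeout (hx : IsExecution S tr) (hfaulty : S.correctᶜ.card ≤ f)
    {w w' k j : ℕ} {p q : Pid f} {h : Block f C} (h0 : FirstEntry S tr w k p) (hw : w ≤ w')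
    (hs : tr.Sends j q (.timeout q w' h)) : tr.time k + 5 * S.Δ ≤ tr.time j := by
  obtain ⟨i, hi, q', hq', h1, d, h2, h3⟩ := hx.timeout_origin hfaulty hs
  obtain ⟨i', hi', h4, h5⟩ := hx.deadline_eq h2
  have h6 : k ≤ i' := by
    by_contra h6
    have := h0.before (i' + 1) (by omega) q' hq'
    omega
  have h7 := hx.time_mono h6
  have h8 := hx.time_mono hi
  linarith

/-! ### Timeouts spread -/

/-- Finitely many facts that hold by time `D`, and persist, hold simultaneously by time `D`. -/
theorem Trace.exists_common {A : Finset (Pid f)} (hA : A.Nonempty) {D : ℝ}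
    {P : Pid f → ℕ → Prop} (hP : ∀ q k k', k ≤ k' → P q k → P q k')
    (h : ∀ q ∈ A, ∃ k, tr.time k ≤ D ∧ P q k) : ∃ k, tr.time k ≤ D ∧ ∀ q ∈ A, P q k := by
  choose! K hK using h
  obtain ⟨q, hq, h1⟩ := A.exists_max_image K hA
  exact ⟨K q, (hK q hq).1, fun q' hq' => hP _ _ _ (h1 q' hq') (hK q' hq').2⟩

theorem IsExecution.delivered (hx : IsExecution S tr) {D : ℝ} (hD : S.GST ≤ D) {j : ℕ} {p : Pid f}
    {m : Msg f C} (hp : p ∈ S.correct) (hm : (p, m) ∈ tr.out j) (hj : tr.time j ≤ D) :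
    ∃ k, tr.time k ≤ D + S.Δ ∧ tr.event k = .deliver p m := by
  obtain ⟨k, -, h1, h2⟩ := hx.delivery j p m hp hm
  exact ⟨k, h2.trans (by gcongr; exact max_le hj hD), h1⟩

theorem IsExecution.tmoSenders_of_timedOut (hx : IsExecution S tr) (hPD : 1 ≤ S.PD) {D : ℝ}
    (hD : S.GST ≤ D) {A : Finset (Pid f)} (hA : A.Nonempty) {w : ℕ}
    (h : ∀ q ∈ A, ∃ k, tr.time k ≤ D ∧ w ∈ (tr.state (k + 1) q).timedOut) {p : Pid f}
    (hp : p ∈ S.correct) :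
    ∃ k, tr.time k ≤ D + S.Δ ∧ A ⊆ (tr.state (k + 1) p).tmoSenders w := by
  refine Trace.exists_common (P := fun q k => q ∈ (tr.state (k + 1) p).tmoSenders w) hA
    (fun q k k' hk h1 => hx.tmoSenders_mono p w (Nat.succ_le_succ hk) h1) fun q hq => ?_
  obtain ⟨k, hk, h1⟩ := h q hq
  obtain ⟨j, hi, hj, -, h2, h3⟩ := hx.timedOut_sent hPD h1
  obtain ⟨k', hk', h4⟩ := hx.delivered hD hp (h3 p)
    ((hx.time_mono (show j ≤ k by omega)).trans hk)
  exact ⟨k', hk', State.mem_tmoSenders.2 ((hx.step_of_deliver h4).timeout_recorded h2)⟩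

/-- If a process has a timeout certificate for `w`, then every correct process learns that `w` has
timed out. -/
theorem IsExecution.timedOut_of_quorum (hx : IsExecution S tr) (hPD : 1 ≤ S.PD)
    (hfaulty : S.correctᶜ.card ≤ f) {D : ℝ} (hD : S.GST ≤ D) {i w : ℕ} {p₀ : Pid f}
    (hi : tr.time i ≤ D) (hc : 2 * f + 1 ≤ ((tr.state (i + 1) p₀).tmoSenders w).card) {p : Pid f}
    (hp : p ∈ S.correct) :
    ∃ k, tr.time k ≤ D + S.Δ ∧
      (w < (tr.state (k + 1) p).view ∨ w ∈ (tr.state (k + 1) p).timedOut) := by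
  have hA := card_inter_correct hfaulty hc
  obtain ⟨k, hk, h1⟩ := hx.tmoSenders_of_timedOut hPD hD (w := w)
    (Finset.card_pos.1 (Nat.lt_of_lt_of_le (Nat.succ_pos _) hA)) (fun q hq => by
      obtain ⟨hq, hq'⟩ := Finset.mem_inter.1 hq
      obtain ⟨j, hj, h, h1⟩ := (hx.timeoutEvidence_of_tmoSenders hc).2 q hq hq'
      obtain ⟨-, h2, q', h3⟩ := hx.step_of_sends h1
      exact ⟨j, (hx.time_mono hj.le).trans hi, (h2.timeout_sent h3).2.2.1⟩) hp
  exact ⟨k, hk, (hx.wf hPD _ p).amplified w (hA.trans (Finset.card_le_card h1))⟩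

/-- If all correct processes have sent timeout messages for `w`, then all of them leave `w`. -/
theorem IsExecution.view_gt_of_timedOut (hx : IsExecution S tr) (hPD : 1 ≤ S.PD)
    (hfaulty : S.correctᶜ.card ≤ f) {D : ℝ} (hD : S.GST ≤ D) {w : ℕ}
    (h : ∀ q ∈ S.correct, ∃ k, tr.time k ≤ D ∧ w ∈ (tr.state (k + 1) q).timedOut) {p : Pid f}
    (hp : p ∈ S.correct) : ∃ k, tr.time k ≤ D + S.Δ ∧ w < (tr.state (k + 1) p).view := by
  obtain ⟨k, hk, h1⟩ := hx.tmoSenders_of_timedOut hPD hD ⟨p, hp⟩ h hp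
  exact ⟨k, hk, (hx.wf hPD _ p).advanced w
    ((card_correct hfaulty).trans (Finset.card_le_card h1))⟩

/-! ### Every view is reached -/

theorem IsExecution.exists_entry (hx : IsExecution S tr) {k w : ℕ} {p : Pid f} (hw : 1 ≤ w)
    (h : (tr.state k p).view = w) :
    ∃ i < k, (tr.state i p).view < w ∧ (tr.state (i + 1) p).view = w := by
  induction k with
  | zero =>
    rw [hx.initial] at h
    change 0 = w at h
    omega
  | succ k ih =>
    by_cases h1 : (tr.state k p).view = w
    · obtain ⟨i, hi, h2⟩ := ih h1
      exact ⟨i, by omega, h2⟩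
    · have h2 := hx.view_mono p (Nat.le_succ k)
      dsimp only [Nat.succ_eq_add_one] at h2
      exact ⟨k, by omega, by omega, h⟩

/-- A process that stays in a view for ever gets a timer event in it. -/
theorem IsExecution.timer_fires (hx : IsExecution S tr) {i w : ℕ} {p : Pid f}
    (hp : p ∈ S.correct) (hi : (tr.state i p).view < w)
    (h : ∀ k, i < k → (tr.state k p).view = w) : ∃ j, i < j ∧ tr.event j = .timer p := by
  by_contra! hn
  have hd : ∀ k, i < k → (tr.state k p).deadline = some (tr.time i + 5 * S.Δ) := by
    intro k hk
    induction k, hk using Nat.le_induction with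
    | base =>
      have h0 := h (i + 1) (Nat.lt_succ_self i)
      rcases hx.step_or_eq i p with h1 | ⟨-, -, h1⟩
      · rw [h1] at h0
        omega
      · rcases h1.deadline_cases with ⟨h2, -⟩ | ⟨h2, -⟩ | ⟨-, h2⟩
        · omega
        · omega
        · exact h2
    | succ k hk ih =>
      have h0 := h k hk
      have h0' := h (k + 1) (by omega)
      rcases hx.step_or_eq k p with h1 | ⟨-, -, h1⟩
      · rw [h1, ih]
      · rcases h1.deadline_cases with ⟨-, h2⟩ | ⟨-, h2⟩ | ⟨h2, -⟩
        · rw [h2, ih]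
        · exact absurd h2 (hn k hk)
        · omega
  obtain ⟨k, hk, h1⟩ := ((hx.time_unbounded.eventually_gt_atTop
    (tr.time i + 5 * S.Δ)).and (Filter.eventually_gt_atTop i)).exists
  have := hx.timers k p hp _ (hd k h1)
  linarith

theorem IsExecution.current_ne_none_of_view_eq (hx : IsExecution S tr) {i w : ℕ} {p : Pid f}
    (h : ∀ k, i < k → (tr.state k p).view = w) (hc : (tr.state (i + 1) p).current ≠ none) {k : ℕ}
    (hk : i < k) : (tr.state k p).current ≠ none := by
  induction k, hk using Nat.le_induction with
  | base => exact hc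
  | succ k hk ih =>
    rcases hx.step_or_eq k p with h1 | ⟨-, -, h1⟩
    · rwa [h1]
    · exact h1.current_ne_none ((h (k + 1) (by omega)).trans (h k hk).symm) ih

theorem IsExecution.view_pos (hx : IsExecution S tr) {p : Pid f} (hp : p ∈ S.correct) :
    ∃ k, tr.time k ≤ S.GST ∧ 1 ≤ (tr.state (k + 1) p).view := by
  obtain ⟨k, h1, h2⟩ := hx.starts p hp
  have h3 : (tr.event k).actor = some p := by rw [h1]; rfl
  have h4 := (hx.step k p h3).step h3
  rw [h1] at h4
  exact ⟨k, h2, h4.view_pos_of_start⟩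

/-- If no correct process ever gets beyond view `w`, then all of them get into it: a block by which
one of them has entered the view is forwarded when its timer expires, and the timeout messages by
which one of them has entered the view make all the others time out. -/
theorem IsExecution.all_enter (hx : IsExecution S tr) (hPD : 1 ≤ S.PD)
    (hfaulty : S.correctᶜ.card ≤ f) {w k₀ : ℕ} {p₀ : Pid f} (hw : 1 ≤ w)
    (hmax : ∀ k, ∀ p ∈ S.correct, (tr.state k p).view ≤ w) (hp₀ : p₀ ∈ S.correct)
    (h₀ : (tr.state k₀ p₀).view = w) {p : Pid f} (hp : p ∈ S.correct) :
    ∃ k, (tr.state k p).view = w := by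
  suffices h : ∃ k, w ≤ (tr.state k p).view by
    obtain ⟨k, hk⟩ := h
    exact ⟨k, le_antisymm (hmax k p hp) hk⟩
  rcases eq_or_lt_of_le hw with rfl | hw1
  · obtain ⟨k, -, hk⟩ := hx.view_pos hp
    exact ⟨k + 1, hk⟩
  by_cases hA : ∃ b j, Valid S b ∧ b.view = w ∧ ∀ q, (q, .proposal b) ∈ tr.out j
  · obtain ⟨b, j, hb, rfl, h1⟩ := hA
    obtain ⟨k, -, h2, -⟩ := hx.delivery j p _ hp (h1 p)
    exact ⟨k + 1, (hx.step_of_deliver h2).view_le_of_proposal hb⟩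
  -- As no block of view `w` is broadcast, view `w` is entered by timeout certificates only.
  have key : ∀ q ∈ S.correct, ∀ k, (tr.state k q).view = w → ∃ u i, i < k ∧ w = u + 1 ∧
      2 * f + 1 ≤ ((tr.state (i + 1) q).tmoSenders u).card ∧
      u ∈ (tr.state (i + 1) q).timedOut := by
    intro q hq k hk
    obtain ⟨i, hi, h1, h2⟩ := hx.exists_entry hw hk
    have hstay : ∀ k, i < k → (tr.state k q).view = w := fun k hk =>
      le_antisymm (hmax k q hq) (h2 ▸ hx.view_mono q hk)
    rcases hx.step_or_eq i q with h3 | ⟨-, -, h3⟩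
    · rw [h3] at h2
      omega
    rcases h3.entry_cases (hx.wf hPD i q) (by omega) with
      ⟨-, h4, -⟩ | ⟨b, -, -, -, h4⟩ | ⟨q', τ, b, -, -, -, -, b', -, h4⟩ | ⟨u, h4, h5, h6, -⟩
    · omega
    · obtain ⟨j, hj, h5⟩ := hx.timer_fires hq h1 hstay
      obtain ⟨b', h6⟩ := Option.ne_none_iff_exists'.1
        (hx.current_ne_none_of_view_eq hstay (by simp [h4]) hj)
      obtain ⟨h7, h8, -⟩ := hx.current_received h6
      have h9 : (tr.event j).actor = some q := by rw [h5]; rfl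
      have h10 := (hx.step j q h9).step h9
      rw [h5] at h10
      exact absurd ⟨b', j, h7, h8.trans (hstay j hj), h10.forwards h6⟩ hA
    · exact absurd ⟨b', i, h4.valid, h4.view_eq.symm.trans h2, h4.sent⟩ hA
    · exact ⟨u, i, hi, by omega, h5, h6⟩
  obtain ⟨u, i, hi, rfl, hc, -⟩ := key p₀ hp₀ k₀ h₀
  have hall : ∀ q ∈ S.correct, ∃ k, tr.time k ≤ max (tr.time i) S.GST + S.Δ ∧
      u ∈ (tr.state (k + 1) q).timedOut := by
    intro q hq
    obtain ⟨k, hk, h1⟩ := hx.timedOut_of_quorum hPD hfaulty (le_max_right _ _)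
      (le_max_left (tr.time i) S.GST) hc hq
    refine ⟨k, hk, h1.elim (fun h2 => ?_) id⟩
    obtain ⟨u', i', hi', h3, -, h4⟩ := key q hq (k + 1) (le_antisymm (hmax _ q hq) h2)
    obtain rfl : u = u' := by omega
    exact hx.timedOut_mono q (show i' + 1 ≤ k + 1 by omega) h4
  obtain ⟨k, -, hk⟩ := hx.view_gt_of_timedOut hPD hfaulty
    (D := max (max (tr.time i) S.GST + S.Δ) S.GST) (le_max_right _ _)
    (fun q hq => by
      obtain ⟨k, hk, h1⟩ := hall q hq
      exact ⟨k, hk.trans (le_max_left _ _), h1⟩) hp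
  exact ⟨k + 1, hk⟩

theorem IsExecution.exists_view_ge (hx : IsExecution S tr) (hPD : 1 ≤ S.PD)
    (hfaulty : S.correctᶜ.card ≤ f) (w : ℕ) :
    ∃ k, ∃ p ∈ S.correct, w ≤ (tr.state k p).view := by
  have hne : S.correct.Nonempty := Finset.card_pos.1 (by have := card_correct hfaulty; omega)
  induction w with
  | zero =>
    obtain ⟨p, hp⟩ := hne
    exact ⟨0, p, hp, Nat.zero_le _⟩
  | succ w ih =>
    by_contra! hn
    have hmax : ∀ k, ∀ p ∈ S.correct, (tr.state k p).view ≤ w := fun k p hp =>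
      Nat.lt_succ_iff.1 (hn k p hp)
    obtain ⟨k₀, p₀, hp₀, h₀⟩ := ih
    have hw : 1 ≤ w := by
      obtain ⟨k, -, hk⟩ := hx.view_pos hp₀
      exact hk.trans (hmax _ p₀ hp₀)
    have h1 : ∀ q ∈ S.correct, ∃ k, w ∈ (tr.state (k + 1) q).timedOut := by
      intro q hq
      obtain ⟨k, hk⟩ := hx.all_enter hPD hfaulty hw hmax hp₀ (le_antisymm (hmax _ _ hp₀) h₀) hq
      obtain ⟨i, -, h2, h3⟩ := hx.exists_entry hw hk
      have hstay : ∀ k, i < k → (tr.state k q).view = w := fun k hk =>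
        le_antisymm (hmax k q hq) (h3 ▸ hx.view_mono q hk)
      obtain ⟨j, hj, h5⟩ := hx.timer_fires hq h2 hstay
      have h9 : (tr.event j).actor = some q := by rw [h5]; rfl
      have h10 := (hx.step j q h9).step h9
      rw [h5] at h10
      exact ⟨j, hstay j hj ▸ h10.timedOut_of_timer⟩
    choose! K hK using h1
    obtain ⟨q, hq, h2⟩ := S.correct.exists_max_image K hne
    obtain ⟨k, -, hk⟩ := hx.view_gt_of_timedOut hPD hfaulty (D := max (tr.time (K q)) S.GST)
      (le_max_right _ _) (fun q' hq' => ⟨K q',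
        (hx.time_mono (h2 q' hq')).trans (le_max_left _ _), hK q' hq'⟩) hp₀
    exact absurd (hmax (k + 1) p₀ hp₀) (by omega)

/-! ### Views of correct leaders after `GST` -/

theorem Genuine.eq_generated (hx : IsExecution S tr) (hPD : 1 ≤ S.PD) {j k : ℕ}
    {b B : Block f C} (hb : Genuine S tr k b) (hbv : Valid S b) (hv : 1 ≤ b.view)
    (hl : S.leader b.view ∈ S.correct) (hB : GeneratedAt S tr j (S.leader b.view) B)
    (hBv : b.view = B.view) : b = B := by
  obtain ⟨i, -, h⟩ := hb.generated hx hPD hbv hv hl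
  exact hx.generated_unique h hB hBv

/-- The field `lastVoted` testifies to a vote. -/
theorem IsExecution.voted (hx : IsExecution S tr) {k : ℕ} {p : Pid f}
    (h : 1 ≤ (tr.state k p).lastVoted) :
    ∃ j < k, ∃ b, b.view = (tr.state k p).lastVoted ∧ (tr.event j).actor = some p ∧
      (S.leader (b.view + 1), .vote p (voteType S b) b) ∈ tr.out j := by
  induction k with
  | zero =>
    rw [hx.initial] at h
    exact absurd h (Nat.not_succ_le_zero 0)
  | succ k ih =>
    rcases hx.step_or_eq k p with h1 | ⟨h0, -, h1⟩
    · rw [h1] at h ⊢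
      obtain ⟨j, hj, h2⟩ := ih h
      exact ⟨j, by omega, h2⟩
    · rcases h1.lastVoted_cases with ⟨h2, -⟩ | ⟨b, -, -, -, -, h2, -, h3⟩
      · rw [h2] at h ⊢
        obtain ⟨j, hj, h2⟩ := ih h
        exact ⟨j, by omega, h2⟩
      · exact ⟨k, by omega, b, h2.symm, h0, h3⟩

/-- As long as no correct process has left view `u` or has timed out, the block of a correct leader
of view `u` gets the votes of all correct processes within `Δ`. -/
theorem GeneratedAt.all_vote (hx : IsExecution S tr) (hPD : 1 ≤ S.PD) {j u : ℕ} {B : Block f C}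
    (hB : GeneratedAt S tr j (S.leader u) B) (hBv : B.view = u) (hu : 1 ≤ u)
    (hl : S.leader u ∈ S.correct) {D : ℝ} (hD : S.GST ≤ D) (hj : tr.time j ≤ D)
    (hview : ∀ k, ∀ p ∈ S.correct, tr.time k ≤ D + S.Δ → (tr.state k p).view ≤ u)
    (htmo : ∀ k p w h, tr.time k ≤ D + S.Δ → tr.Sends k p (.timeout p w h) → w < u)
    {p : Pid f} (hp : p ∈ S.correct) :
    ∃ k, tr.time k ≤ D + S.Δ ∧ (tr.event k).actor = some p ∧
      (S.leader (u + 1), .vote p (voteType S B) B) ∈ tr.out k := by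
  subst hBv
  obtain ⟨k, hk, h1⟩ := hx.delivered hD hp (hB.2.sent p) hj
  have hstep := hx.step_of_deliver h1
  have hv := hview k p hp hk
  have hlv := (hx.wf hPD k p).voted_view.trans hv
  rcases Nat.lt_or_eq_of_le hlv with h2 | h2
  · refine ⟨k, hk, by rw [h1]; rfl, hstep.casts_vote hB.2.valid hv h2 fun w hw => ?_⟩
    obtain ⟨i, h, hi, h3, -, h4⟩ := hx.timedOut_sent hPD hw
    exact htmo i p w h ((hx.time_mono hi.le).trans hk) ⟨h3, p, h4 p⟩
  -- A process that has already voted in view `u` has voted for the same block.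
  · obtain ⟨i, hi, b, h3, h4, h5⟩ := hx.voted (h2 ▸ hu)
    rw [h2] at h3
    obtain ⟨-, h6, h7, -, h8, -⟩ := hx.of_vote ⟨h4, _, h5⟩
    obtain rfl := h6.eq_generated hx hPD h7 h8 (h3 ▸ hl) (h3 ▸ hB) h3
    exact ⟨i, (hx.time_mono hi.le).trans hk, h4, h5⟩

/-- Within `2Δ` after the first correct process, a correct leader gets into its view. -/
theorem FirstEntry.leader_generates (hx : IsExecution S tr) (hPD : 1 ≤ S.PD)
    (hfaulty : S.correctᶜ.card ≤ f) (hΔ : 0 < S.Δ) {u k₀ : ℕ} {p₀ : Pid f} (hu : 1 ≤ u)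
    (hl : S.leader u ∈ S.correct) (h₀ : FirstEntry S tr u k₀ p₀) (hg : S.GST ≤ tr.time k₀)
    (hview : ∀ k, ∀ p ∈ S.correct, tr.time k ≤ tr.time k₀ + 2 * S.Δ →
      (tr.state (k + 1) p).view ≤ u) :
    ∃ j, tr.time j ≤ tr.time k₀ + 2 * S.Δ ∧ ∃ B, B.view = u ∧
      GeneratedAt S tr j (S.leader u) B := by
  suffices h : ∃ k, tr.time k ≤ tr.time k₀ + 2 * S.Δ ∧
      u ≤ (tr.state (k + 1) (S.leader u)).view by
    obtain ⟨k, hk, h1⟩ := h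
    obtain ⟨j, hj, B, h2⟩ := hx.leader_generates hPD hl hu (le_antisymm (hview k _ hl hk) h1)
    exact ⟨j, (hx.time_mono (show j ≤ k by omega)).trans hk, B, h2⟩
  rcases eq_or_lt_of_le hu with rfl | hu1
  · obtain ⟨k, hk, h1⟩ := hx.view_pos hl
    exact ⟨k, by linarith, h1⟩
  by_contra! hn
  -- As the leader does not enter its view, the others enter it by timeout certificates only.
  have key : ∀ q ∈ S.correct, ∀ k, tr.time k ≤ tr.time k₀ + 2 * S.Δ →
      (tr.state (k + 1) q).view = u → ∃ w i, i ≤ k ∧ u = w + 1 ∧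
      2 * f + 1 ≤ ((tr.state (i + 1) q).tmoSenders w).card ∧
      w ∈ (tr.state (i + 1) q).timedOut := by
    intro q hq k hk h1
    obtain ⟨i, hi, h2, h3⟩ := hx.exists_entry hu h1
    have hit := (hx.time_mono (show i ≤ k by omega)).trans hk
    rcases hx.step_or_eq i q with h4 | ⟨-, -, h4⟩
    · rw [h4] at h3
      omega
    rcases h4.entry_cases (hx.wf hPD i q) (by omega) with
      ⟨-, h5, -⟩ | ⟨b, h5, h6, h7, -⟩ | ⟨q', τ, b, -, h5, rfl, -⟩ | ⟨w, h5, h6, h7, -⟩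
    · omega
    · have h8 : b.view = u := h7.trans h3
      subst h8
      obtain ⟨j, hj, h9⟩ := (hx.genuine_of_deliver h5).generated hx hPD h6 hu hl
      exact absurd (hn j ((hx.time_mono hj.le).trans hit)) (by rw [h9.2.view_eq]; exact lt_irrefl _)
    · rw [h3] at h5
      have := hn i hit
      rw [h5] at this
      omega
    · exact ⟨w, i, by omega, by omega, h6, h7⟩
  obtain ⟨w, i, hi, rfl, hc, -⟩ := key p₀ h₀.correct k₀ (by linarith)
    (h₀.view_eq hx hPD hfaulty hu)
  obtain ⟨k, hk, h1⟩ := hx.view_gt_of_timedOut hPD hfaulty (D := tr.time k₀ + S.Δ) (w := w)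
    (by linarith) (fun q hq => by
      obtain ⟨k, hk, h1⟩ := hx.timedOut_of_quorum hPD hfaulty hg (hx.time_mono hi) hc hq
      refine ⟨k, hk, h1.elim (fun h2 => ?_) id⟩
      obtain ⟨w', i', hi', h3, -, h4⟩ := key q hq k (by linarith)
        (le_antisymm (hview k q hq (by linarith)) h2)
      obtain rfl : w = w' := by omega
      exact hx.timedOut_mono q (show i' + 1 ≤ k + 1 by omega) h4) hl
  exact absurd (hn k (by linarith)) (by omega)

/-- If the views `u` and `u + 1` have correct leaders and `u` is entered after `GST`, then the first
process to leave `u` is the leader of `u + 1`, at most `4Δ` later and on account of a quorum of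
votes for the block of view `u`. -/
theorem FirstEntry.next (hx : IsExecution S tr) (hPD : 1 ≤ S.PD)
    (hfaulty : S.correctᶜ.card ≤ f) (hΔ : 0 < S.Δ) {u k₀ k₁ : ℕ} {p₀ p₁ : Pid f} (hu : 1 ≤ u)
    (hl : S.leader u ∈ S.correct) (hl' : S.leader (u + 1) ∈ S.correct)
    (h₀ : FirstEntry S tr u k₀ p₀) (hg : S.GST ≤ tr.time k₀)
    (h₁ : FirstEntry S tr (u + 1) k₁ p₁) :
    p₁ = S.leader (u + 1) ∧ ∃ b c τ Q, b.view = u ∧ VoteEvidence S tr k₁ b τ Q ∧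
      GeneratedAt S tr k₁ p₁ (.byQC p₁ (u + 1) c b b τ Q) := by
  -- If all correct processes stayed in view `u` until `4Δ` after the first entry, then the leader of
  -- `u + 1` would have received a quorum of votes by then.
  have htime : tr.time k₁ ≤ tr.time k₀ + 4 * S.Δ := by
    by_contra! hlt
    have hview : ∀ k, ∀ p ∈ S.correct, tr.time k ≤ tr.time k₀ + 4 * S.Δ →
        (tr.state (k + 1) p).view ≤ u := fun k p hp hk => by
      have h2 : k < k₁ := by
        by_contra! h2
        have := hx.time_mono h2
        linarith
      exact Nat.lt_succ_iff.1 (h₁.before (k + 1) h2 p hp)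
    obtain ⟨j, hj, B, hBv, hB⟩ := h₀.leader_generates hx hPD hfaulty hΔ hu hl hg
      fun k p hp hk => hview k p hp (by linarith)
    have hvotes := fun p hp => hB.all_vote hx hPD hBv hu hl (p := p)
      (D := tr.time k₀ + 2 * S.Δ) (by linarith) hj
      (fun k p hp hk => (hx.view_mono p (Nat.le_succ k)).trans (hview k p hp (by linarith)))
      (fun k p w h hk hs => by
        by_contra! hw
        have := h₀.time_of_timeout hx hfaulty hw hs
        linarith) hp
    obtain ⟨k, hk, h2⟩ := Trace.exists_common (tr := tr) (A := S.correct)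
      (D := tr.time k₀ + 4 * S.Δ)
      (P := fun q k => (q, voteType S B, B) ∈ (tr.state (k + 1) (S.leader (u + 1))).votes)
      ⟨_, hl⟩ (fun q k k' hk h => hx.votes_mono _ (Nat.succ_le_succ hk) h) (fun q hq => by
        obtain ⟨k, hk, -, h2⟩ := hvotes q hq
        obtain ⟨k', hk', h3⟩ := hx.delivered (by linarith) hl' h2 hk
        exact ⟨k', by linarith, (hx.step_of_deliver h3).vote_recorded⟩)
    have h3 := (hx.wf hPD (k + 1) (S.leader (u + 1))).certified (voteType S B) B (by rw [hBv])
      ((card_correct hfaulty).trans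
        (Finset.card_le_card fun q hq => State.mem_voters.2 (h2 q hq)))
    have := hview k _ hl' hk
    omega
  have hv := h₁.view_eq hx hPD hfaulty (by omega)
  rcases hx.step_or_eq k₁ p₁ with h2 | ⟨hact, -, h2⟩
  · exact absurd (by rw [h2]) h₁.view_ne
  rcases h2.entry_cases (hx.wf hPD k₁ p₁) h₁.view_ne with
    ⟨-, h3, -⟩ | ⟨b, h3, h4, h5, -⟩ | ⟨q, τ, b, -, h3, h4, h5, b', ⟨c, rfl⟩, h6⟩ | ⟨w, h3, h4, -⟩
  · omega
  · rw [hv] at h5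
    obtain ⟨j, hj, h6⟩ := (hx.genuine_of_deliver h3).generated hx hPD h4 (by omega)
      (by rwa [h5])
    rw [h5] at h6
    have h7 := h₁.before (j + 1) hj _ hl'
    have h8 := h6.2.view_eq
    omega
  · obtain rfl : b.view = u := by omega
    exact ⟨h4.symm, b, c, τ, _, rfl, hx.voteEvidence_of_voters h5, hact, h6⟩
  · obtain rfl : w = u := by omega
    obtain ⟨j, hj, q, hi, h5⟩ := (hx.timeoutEvidence_of_tmoSenders h4).sent hfaulty
    have := h₀.time_of_timeout hx hfaulty le_rfl h5
    have := hx.time_mono hj.le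
    linarith

/-- A block that a correct leader generates on entering its view as the first correct process gets
votes of at least `f + 1` correct processes: if some process leaves the view so early that not all
correct processes can vote, then it does so on account of a quorum of votes. -/
theorem FirstEntry.exists_voters (hx : IsExecution S tr) (hPD : 1 ≤ S.PD)
    (hfaulty : S.correctᶜ.card ≤ f) (hΔ : 0 < S.Δ) {u k₁ : ℕ} {B : Block f C} (hu : 1 ≤ u)
    (h₁ : FirstEntry S tr u k₁ (S.leader u)) (hg : S.GST ≤ tr.time k₁)
    (hB : GeneratedAt S tr k₁ (S.leader u) B) (hBv : B.view = u) :
    ∃ V ⊆ S.correct, f + 1 ≤ V.card ∧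
      ∀ q ∈ V, ∃ k τ b, b.view = u ∧ tr.Sends k q (.vote q τ b) := by
  have htmo : ∀ k p w h, tr.time k ≤ tr.time k₁ + S.Δ → tr.Sends k p (.timeout p w h) →
      w < u := fun k p w h hk hs => by
    by_contra! hw
    have := h₁.time_of_timeout hx hfaulty hw hs
    linarith
  obtain ⟨k₂, p₂, h₂⟩ := hx.exists_firstEntry (w := u + 1) (by omega)
    (hx.exists_view_ge hPD hfaulty _)
  rcases lt_or_ge (tr.time k₁ + S.Δ) (tr.time k₂) with hlt | hle
  · refine ⟨S.correct, subset_rfl, by have := card_correct hfaulty; omega, fun q hq => ?_⟩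
    obtain ⟨k, -, h3, h4⟩ := hB.all_vote hx hPD hBv hu h₁.correct hg le_rfl
      (fun k p hp hk => by
        have h5 : k ≤ k₂ := by
          by_contra! h5
          have := hx.time_mono h5.le
          linarith
        exact Nat.lt_succ_iff.1 (h₂.before k h5 p hp)) htmo hq
    exact ⟨k, _, B, hBv, h3, _, h4⟩
  · have hv := h₂.view_eq hx hPD hfaulty (by omega)
    rcases hx.entry_evidence hPD h₂.view_ne with h3 | ⟨b, τ, Q, h3, h4⟩ | ⟨w, Q, h3, h4⟩
    · omega
    · refine ⟨Q ∩ S.correct, Finset.inter_subset_right, card_inter_correct hfaulty h3.1,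
        fun q hq => ?_⟩
      obtain ⟨hq, hq'⟩ := Finset.mem_inter.1 hq
      obtain ⟨j, -, h5⟩ := h3.2 q hq hq'
      exact ⟨j, τ, b, by omega, h5⟩
    · obtain ⟨j, hj, q, h, h5⟩ := h3.sent hfaulty
      have := htmo j q w h ((hx.time_mono hj.le).trans hle) h5
      omega

/-! ### Blocks above a view with a quorum of correct voters -/

/-- A process of the set `V` has voted in view `u` before it can time out in a view `≥ u`, so a
timeout certificate for such a view contains a `high_vote` of view `≥ u`, and so does its block of
highest rank. -/
theorem Genuine.parent_view_ge (hx : IsExecution S tr) {u : ℕ} {V : Finset (Pid f)}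
    (hVc : V ⊆ S.correct) (hV : f + 1 ≤ V.card)
    (hvote : ∀ q ∈ V, ∃ k τ b, b.view = u ∧ tr.Sends k q (.vote q τ b)) {k : ℕ}
    (hhigh : ∀ j < k, ∀ q ∈ S.correct, u ≤ (tr.state j q).lastVoted →
      u ≤ (tr.state j q).highVote.view)
    {i v c par qb τ Q n T high} (hb : Valid S (.byTC i v c par qb τ Q n T high))
    (hg : Genuine S tr k (.byTC i v c par qb τ Q n T high)) (hv : u < v) : u ≤ par.view := by
  obtain ⟨⟨-, -, -, -, -, hT, -, hpar⟩, -⟩ := explicitlyValid_of_valid_byTC hb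
  obtain ⟨q, hqT, hqV⟩ := exists_mem_of_quorums hT hV
  obtain ⟨-, -, w, rfl, h1⟩ := hg.of_byTC hb
  obtain ⟨j, hj, h2⟩ := h1 ⟨q, hqT⟩ (hVc hqV)
  obtain ⟨-, hstep, q', hq'⟩ := hx.step_of_sends h2
  obtain ⟨-, h3, h4, h5⟩ := hstep.timeout_sent hq'
  obtain ⟨i', τ', b, hbu, h6⟩ := hvote q hqV
  obtain ⟨h7, -, -, -, -, -, h8, h9⟩ := hx.of_vote h6
  -- A vote in view `u` is refused after a timeout of a view `≥ u`.
  have hij : i' < j := by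
    by_contra! hji
    rcases Nat.lt_or_eq_of_le hji with hji | rfl
    · have := h9 w (hx.timedOut_mono q (show j + 1 ≤ i' from hji) h4)
      omega
    · rcases h5 with ⟨h5, -⟩ | ⟨h5, -⟩
      · rw [h7] at h5
        cases h5
      · exact h5 b h7
  have h10 : u ≤ (tr.state j q).lastVoted := by
    have := hx.lastVoted_mono q (show i' + 1 ≤ j from hij)
    dsimp only at this
    omega
  have h11 := hhigh j hj q (hVc hqV) h10
  rw [← h3] at h11
  by_contra! h12
  exact hpar ⟨q, hqT⟩ (.inl (h12.trans_le h11))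

/-- A process that has voted in a view `≥ u` keeps a `high_vote` of a view `≥ u`. When it votes for a
prudent block, its `high_vote` becomes the parent, whose view is `≥ u` on account of earlier
`high_vote` fields in the timeout certificate of the block. -/
theorem IsExecution.highVote_view_ge (hx : IsExecution S tr) (hPD : 1 ≤ S.PD) {u : ℕ}
    {V : Finset (Pid f)} (hu : 1 ≤ u) (hVc : V ⊆ S.correct) (hV : f + 1 ≤ V.card)
    (hvote : ∀ q ∈ V, ∃ k τ b, b.view = u ∧ tr.Sends k q (.vote q τ b))
    (hnp : ∀ k b, Genuine S tr k b → Valid S b → b.view = u → ¬ Prudent S b) (k : ℕ) :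
    ∀ q ∈ S.correct, u ≤ (tr.state k q).lastVoted → u ≤ (tr.state k q).highVote.view := by
  induction k using Nat.strong_induction_on with
  | _ k ih =>
    intro q hq hlv
    cases k with
    | zero =>
      rw [hx.initial] at hlv
      change u ≤ 0 at hlv
      omega
    | succ k =>
      rcases hx.step_or_eq k q with h1 | ⟨-, -, h1⟩
      · rw [h1] at hlv ⊢
        exact ih k (by omega) q hq hlv
      rcases h1.lastVoted_cases with ⟨h2, h3⟩ | ⟨b, h2, h3, -, -, h4, h5, -⟩
      · rw [h2] at hlv
        rw [h3]
        exact ih k (by omega) q hq hlv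
      rw [h4] at hlv
      rcases h5 with ⟨h5, -⟩ | ⟨h5, h6⟩ <;> rw [h5]
      · exact hlv
      have hg := hx.genuine_of_deliver h2
      have hlt : u < b.view := lt_of_le_of_ne hlv fun h => hnp k b hg h3 h.symm h6
      cases b with
      | genesis => exact absurd hlt (Nat.not_lt_zero u)
      | byQC =>
        change 0 = S.PD at h6
        omega
      | byTC => exact hg.parent_view_ge hx hVc hV hvote (fun j hj => ih j (by omega)) h3 hlt

theorem Block.IsAncestorOrSelf.of_parent {a b : Block f C} (h : a.IsAncestorOrSelf b.parent) :
    a.IsAncestorOrSelf b := by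
  obtain ⟨k, hk⟩ := h
  exact ⟨k + 1, hk⟩

/-- If `B` lies below all blocks of view `u` and below the blocks that these certify, then the same
holds for all later views. -/
theorem Genuine.extends (hx : IsExecution S tr) (hPD : 1 ≤ S.PD)
    (hfaulty : S.correctᶜ.card ≤ f) {u : ℕ} {V : Finset (Pid f)} {B : Block f C} (hu : 1 ≤ u)
    (hVc : V ⊆ S.correct) (hV : f + 1 ≤ V.card)
    (hvote : ∀ q ∈ V, ∃ k τ b, b.view = u ∧ tr.Sends k q (.vote q τ b))
    (hnp : ∀ k b, Genuine S tr k b → Valid S b → b.view = u → ¬ Prudent S b)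
    (hbase : ∀ k b, Genuine S tr k b → Valid S b → b.view = u →
      B.IsAncestorOrSelf b ∧ B.IsAncestorOrSelf (nonPrudQC b).1)
    {k : ℕ} {b : Block f C} (hg : Genuine S tr k b) (hb : Valid S b) (hv : u ≤ b.view) :
    B.IsAncestorOrSelf b ∧ B.IsAncestorOrSelf (nonPrudQC b).1 := by
  induction hn : b.view using Nat.strong_induction_on generalizing b with
  | _ n ih =>
    subst hn
    rcases Nat.eq_or_lt_of_le hv with h | hlt
    · exact hbase k b hg hb h.symm
    cases b with
    | genesis => exact absurd hlt (Nat.not_lt_zero u)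
    | byQC i v c par qb τ Q =>
      obtain ⟨rfl, rfl, h1⟩ := hg.of_byQC hb
      change u < qb.view + 1 at hlt
      rcases h1 with rfl | h1
      · change u < 0 + 1 at hlt
        omega
      obtain ⟨h2, h3, -⟩ := h1.block hx hfaulty
      obtain ⟨h4, h5⟩ := ih qb.view (Nat.lt_succ_self _) h2 h3 (by omega) rfl
      refine ⟨.of_parent h4, ?_⟩
      rw [nonPrudQC]
      split_ifs
      exacts [h5, h4]
    | byTC i v c par qb τ Q m T high =>
      have hpar := hg.parent_view_ge hx hVc hV hvote
        (fun j _ => hx.highVote_view_ge hPD hu hVc hV hvote hnp j) hb hlt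
      obtain ⟨h1, h2, -⟩ := hg.of_byTC hb
      obtain ⟨⟨-, hlt', h3, -⟩, -⟩ := explicitlyValid_of_valid_byTC hb
      obtain ⟨h4, h5⟩ := ih par.view hlt' h1 h2 hpar rfl
      refine ⟨.of_parent h4, ?_⟩
      -- The certificate of the block is that of its parent, which is not the genesis block.
      have h6 : nonPrudQC (.byTC i v c par qb τ Q m T high) = nonPrudQC par := by
        cases par with
        | genesis => exact absurd hpar (by change ¬ u ≤ 0; omega)
        | byQC => cases h3; simp only [nonPrudQC]
        | byTC => cases h3; simp only [nonPrudQC]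
      rwa [h6]

end Executions

end PBeeGees

theorem mainTheorem2 {f : ℕ} {C : Type*} (S : PBeeGees.System f C)
    (hfaulty : S.correctᶜ.card ≤ f) (hPD : 1 ≤ S.PD) (hΔ : 0 < S.Δ)
    (tr : PBeeGees.Trace f C) (hexec : PBeeGees.IsExecution S tr)
    (v v' : ℕ) (hv : 1 ≤ v) (hvv' : v + 1 < v')
    (hv0 : S.leader v ∈ S.correct) (hv1 : S.leader (v + 1) ∈ S.correct)
    (hv'0 : S.leader v' ∈ S.correct) (hv'1 : S.leader (v' + 1) ∈ S.correct)
    (hGST : ∀ t ∈ PBeeGees.entryTimes S tr v, S.GST ≤ t)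
    (hideal : ∀ b, PBeeGees.Proposed S tr v b → ¬ PBeeGees.Prudent S b)
    (hideal' : ∀ b, PBeeGees.Proposed S tr v' b → PBeeGees.voteType S b = .normal) :
    ∃ B, PBeeGees.Proposed S tr v B ∧ (∀ b, PBeeGees.Proposed S tr v b → b = B) ∧
      ∃ T, IsLeast (PBeeGees.entryTimes S tr (v' + 1)) T ∧
        ∀ p ∈ S.correct, PBeeGees.CommittedBy tr p B (T + S.Δ) := by
  open PBeeGees in
  have first : ∀ w, 1 ≤ w → ∃ k p, FirstEntry S tr w k p := fun w hw =>
    hexec.exists_firstEntry hw (hexec.exists_view_ge hPD hfaulty w)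
  have later : ∀ {w w' k k' p p'}, w ≤ w' → FirstEntry S tr w k p → FirstEntry S tr w' k' p' →
      tr.time k ≤ tr.time k' := fun {w w' k k' p p'} hw h h' => by
    refine hexec.time_mono (le_of_not_gt fun hlt => ?_)
    have h1 := h.before (k' + 1) hlt p' h'.correct
    have h2 := h'.entry
    omega
  have proposed : ∀ {w j b}, S.leader w ∈ S.correct → GeneratedAt S tr j (S.leader w) b →
      b.view = w → Proposed S tr w b := fun _ h hb =>
    ⟨hb, h.2.proposer, _, h.1, _, h.2.sent (S.leader v)⟩
  -- For `u = v` and `u = v'`: the block of view `u` is certified by the block of view `u + 1`.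
  have good : ∀ {u k₀ p₀}, 1 ≤ u → S.leader u ∈ S.correct → S.leader (u + 1) ∈ S.correct →
      FirstEntry S tr u k₀ p₀ → S.GST ≤ tr.time k₀ →
      ∃ k₁ j k B c Q, FirstEntry S tr (u + 1) k₁ (S.leader (u + 1)) ∧ B.view = u ∧
        GeneratedAt S tr j (S.leader u) B ∧ Genuine S tr k B ∧ Valid S B ∧
        GeneratedAt S tr k₁ (S.leader (u + 1))
          (.byQC (S.leader (u + 1)) (u + 1) c B B (voteType S B) Q) := by
    intro u k₀ p₀ hu hl hl' h₀ hg
    obtain ⟨k₁, p₁, h₁⟩ := first (u + 1) (by omega)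
    obtain ⟨rfl, B, c, τ, Q, rfl, hE, hB⟩ := h₀.next hexec hPD hfaulty hΔ hu hl hl' hg h₁
    obtain ⟨h1, h2, rfl, -⟩ := hE.block hexec hfaulty
    obtain ⟨j, -, h3⟩ := h1.generated hexec hPD h2 hu hl
    exact ⟨k₁, j, k₁, B, c, Q, h₁, rfl, h3, h1, h2, hB⟩
  obtain ⟨k₀, p₀, h₀⟩ := first v hv
  have hg : S.GST ≤ tr.time k₀ := hGST _ ⟨k₀, p₀, h₀.correct, rfl, h₀.before k₀ le_rfl p₀ h₀.correct,
    h₀.view_eq hexec hPD hfaulty hv⟩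
  obtain ⟨k₁, j, -, B, c, Q, h₁, hBv, hB, -, -, hB₁⟩ := good hv hv0 hv1 h₀ hg
  refine ⟨B, proposed hv0 hB hBv, fun b hb => ?_, ?_⟩
  · obtain ⟨hbv, hbp, k, hk⟩ := hb
    obtain ⟨i, -, h1⟩ := hexec.generated_of_sends hPD hk hbp
    exact hexec.generated_unique h1 hB (hbv.trans hBv.symm)
  have hBnp := hideal B (proposed hv0 hB hBv)
  obtain ⟨V, hVc, hV, hvote⟩ := h₁.exists_voters hexec hPD hfaulty hΔ (by omega)
    (hg.trans (later (by omega) h₀ h₁)) hB₁ rfl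
  -- As the leader of view `v + 1` is correct, its block is the only valid one of this view.
  have hunique : ∀ k b, Genuine S tr k b → Valid S b → b.view = v + 1 →
      b = .byQC (S.leader (v + 1)) (v + 1) c B B (voteType S B) Q := fun k b h1 h2 h3 =>
    h1.eq_generated hexec hPD h2 (by omega) (by rwa [h3]) (by rwa [h3]) h3
  obtain ⟨k₂, p₂, h₂⟩ := first v' (by omega)
  obtain ⟨k₃, j', kg, B', c', Q', h₃, hBv', hB', hBg', hBV', hB₃⟩ :=
    good (by omega) hv'0 hv'1 h₂ (hg.trans (later (by omega) h₀ h₂))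
  rw [hideal' B' (proposed hv'0 hB' hBv')] at hB₃
  have hext : B.IsAncestorOrSelf (nonPrudQC B').1 :=
    (hBg'.extends hexec hPD hfaulty (u := v + 1) (by omega) hVc hV hvote
      (fun k b h1 h2 h3 => by
        rw [hunique k b h1 h2 h3]
        change ¬ 0 = S.PD
        omega)
      (fun k b h1 h2 h3 => by
        rw [hunique k b h1 h2 h3]
        refine ⟨⟨1, rfl⟩, 0, ?_⟩
        rw [nonPrudQC, if_neg (by rwa [voteType_isPrud_iff])]
        rfl) hBV' (by omega)).2
  have hnew : B ∈ newlyCommitted (.byQC (S.leader (v' + 1)) (v' + 1) c' B' B' .normal Q') := by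
    refine ⟨_, ?_, hext⟩
    simp [commitRule, nonPrudQC, VoteType.IsPrud]
  refine ⟨tr.time k₃, ⟨⟨k₃, _, hv'1, rfl, h₃.before k₃ le_rfl _ hv'1,
    h₃.view_eq hexec hPD hfaulty (by omega)⟩, ?_⟩, fun p hp => ?_⟩
  · rintro _ ⟨k, p, hp, rfl, -, h⟩
    refine hexec.time_mono (le_of_not_gt fun hlt => ?_)
    have := h₃.before (k + 1) hlt p hp
    omega
  · obtain ⟨k, hk, h⟩ := hexec.delivered (hg.trans (later (by omega) h₀ h₃)) hp
      (hB₃.2.sent p) le_rfl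
    exact ⟨k, hk, (hexec.step_of_deliver h).commits_of_proposal hB₃.2.valid hnew⟩
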